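/- Let $s\ge 2$ and $t$ be coprime natural numbers, and put $c=\tfrac12(s-1)(t-1)$ and $u=\lfloor s/2\rfloor$. A partition $\lambda=(\lambda_1\ge\lambda_2\ge\cdots)$ is an $s$-core if none of its hook lengths equals $s$, and is self-conjugate if its Young diagram is symmetric in the diagonal. A $t$-core of $\lambda$ is a $t$-core obtained from $\lambda$ by repeatedly removing rim hooks of length $t$. Let $W_s$ be the affine symmetric group, i.e. the group of permutations $w$ of $\mathbb Z$ with $w(m+s)=w(m)+s$ for all $m$ and $w(0)+\dots+w(s-1)=\binom s2$. It is generated by the elements $w_i$ ($i\in\mathbb Z/s\mathbb Z$), where $w_i(m)=m+1$ if $m\in i-1$, $w_i(m)=m-1$ if $m\in i$, and $w_i(m)=m$ otherwise. Let $H_s\le W_s$ be the affine hyperoctahedral group of degree $u$, generated by the elements $v_i$ ($i\in\mathbb Z/s\mathbb Z$), where $v_0=w_0$; $v_i=w_iw_{-i}w_i$ if $i$ is the class of $u$ or of $-u$; and $v_i=w_iw_{-i}$ otherwise. The level $t$ action $w\mapsto\bar w$ of $W_s$ on $\mathbb Z$ is the homomorphism determined by $\bar w_i(m)=m+t$ if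 $m\in(i-1)t-c$, $\bar w_i(m)=m-t$ if $m\in it-c$, and $\bar w_i(m)=m$ otherwise. The level $t$ action $w\mapsto\check w$ of $W_s$ on partitions is determined by $B(\check w\lambda)=\bar w\,B(\lambda)$, where $B(\lambda)=\{\lambda_r-r: r\ge1\}$. Then: 1. The level $t$ action of $H_s$ preserves the set of self-conjugate $s$-cores, and every self-conjugate $s$-core has a unique $t$-core. 2. Two self-conjugate $s$-cores have the same $t$-core if and only if they lie in the same orbit under the level $t$ action of $H_s$. 3. The $t$-core of a self-conjugate $s$-core $\lambda$ is again a self-conjugate $s$-core, and it lies in the same orbit as $\lambda$ under the level $t$ action of $H_s$. -/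

import Mathlib

namespace SCCore

/-! ### The affine symmetric group -/

/-- The displacement `w a - a` of `w`, where `a` is the representative of `i` in `[0, s)`.
For an `s`-periodic `w` any other representative gives the same value. -/
def disp (s : ℕ) (w : ℤ → ℤ) (i : ZMod s) : ℤ := w (i.val : ℤ) - (i.val : ℤ)

theorem periodic_mul {s : ℕ} {w : ℤ → ℤ} (hw : ∀ m, w (m + s) = w m + s) (m k : ℤ) :
    w (m + s * k) = w m + s * k := by
  induction k using Int.induction_on with
  | zero => simp
  | succ k ih =>
    have h := hw (m + s * k)
    rw [ih] at h
    rw [show m + (s : ℤ) * (k + 1) = m + s * k + s by ring, h]; ring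
  | pred k ih =>
    have h := hw (m + s * (-k - 1))
    rw [show m + (s : ℤ) * (-k - 1) + s = m + s * (-k) by ring, ih] at h
    linarith

theorem exists_mul_of_cast_eq {s : ℕ} {a b : ℤ} (h : (a : ZMod s) = b) : ∃ k : ℤ, a = b + s * k := by
  have := (ZMod.intCast_eq_intCast_iff_dvd_sub b a s).1 h.symm
  obtain ⟨k, hk⟩ := this
  exact ⟨k, by linarith⟩

theorem disp_cast {s : ℕ} [NeZero s] {w : ℤ → ℤ} (hw : ∀ m, w (m + s) = w m + s) (m : ℤ) :
    disp s w (m : ZMod s) = w m - m := by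
  obtain ⟨k, hk⟩ : ∃ k : ℤ, m = ((m : ZMod s).val : ℤ) + s * k := by
    apply exists_mul_of_cast_eq
    simp
  have h := periodic_mul hw ((m : ZMod s).val : ℤ) k
  rw [← hk] at h
  unfold disp
  rw [h]; linarith

/-- The map induced on residue classes modulo `s` by an `s`-periodic permutation is bijective. -/
theorem residue_bijective {s : ℕ} [NeZero s] (w : Equiv.Perm ℤ) (hw : ∀ m, w (m + s) = w m + s) :
    Function.Bijective (fun i : ZMod s => i + (disp s w i : ZMod s)) := by
  rw [← Finite.injective_iff_bijective]
  intro i j hij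
  have key : ∀ i : ZMod s, i + (disp s w i : ZMod s) = ((w (i.val : ℤ) : ℤ) : ZMod s) := by
    intro i; simp [disp]
  simp only [key] at hij
  obtain ⟨k, hk⟩ := exists_mul_of_cast_eq hij
  rw [← periodic_mul hw] at hk
  have := congrArg (fun z : ℤ => (z : ZMod s)) (w.injective hk)
  simpa using this

theorem sum_zmod {s : ℕ} [NeZero s] (f : ℕ → ℤ) :
    ∑ i : ZMod s, f i.val = ∑ m ∈ Finset.range s, f m := by
  refine Finset.sum_nbij' (fun i => i.val) (fun m => (m : ZMod s)) ?_ ?_ ?_ ?_ ?_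
  · intro i _; simpa using ZMod.val_lt i
  · intro m _; simp
  · intro i _; simp
  · intro m hm; exact ZMod.val_cast_of_lt (by simpa using hm)
  · intro i _; rfl

theorem sum_range_cast (s : ℕ) : ∑ m ∈ Finset.range s, (m : ℤ) = (s.choose 2 : ℕ) := by
  rw [Nat.choose_two_right, ← Finset.sum_range_id]; push_cast; rfl

theorem sum_disp {s : ℕ} [NeZero s] (w : ℤ → ℤ) :
    ∑ m ∈ Finset.range s, w m = (s.choose 2 : ℕ) ↔ ∑ i : ZMod s, disp s w i = 0 := by
  have : ∑ i : ZMod s, disp s w i = ∑ m ∈ Finset.range s, (w m - m) :=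
    sum_zmod (fun m => w m - m)
  rw [this, Finset.sum_sub_distrib, sum_range_cast, sub_eq_zero]

theorem disp_mul {s : ℕ} [NeZero s] {w v : ℤ → ℤ} (hw : ∀ m, w (m + s) = w m + s) (i : ZMod s) :
    disp s (fun m => w (v m)) i = disp s w (i + (disp s v i : ZMod s)) + disp s v i := by
  have : i + (disp s v i : ZMod s) = ((v (i.val : ℤ) : ℤ) : ZMod s) := by simp [disp]
  rw [this, disp_cast hw]
  simp only [disp]; ring

/-- The affine symmetric group of degree `s`: the permutations `w` of `ℤ` with
`w (m + s) = w m + s` for all `m` and `w 0 + ⋯ + w (s - 1) = s.choose 2`. -/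
def affineSymm (s : ℕ) [NeZero s] : Subgroup (Equiv.Perm ℤ) where
  carrier := {w | (∀ m, w (m + s) = w m + s) ∧
    ∑ m ∈ Finset.range s, w (m : ℤ) = (s.choose 2 : ℕ)}
  one_mem' := by
    refine ⟨fun m => rfl, ?_⟩
    simpa using sum_range_cast s
  mul_mem' := by
    rintro w v ⟨hw, hw'⟩ ⟨hv, hv'⟩
    refine ⟨fun m => by simp [hv, hw], ?_⟩
    rw [sum_disp] at *
    have h : ∀ i : ZMod s, disp s (w * v : Equiv.Perm ℤ) i
        = disp s w (i + (disp s v i : ZMod s)) + disp s v i := fun i => disp_mul hw i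
    simp only [h]
    rw [Finset.sum_add_distrib, hv', add_zero,
      (residue_bijective v hv).sum_comp (fun i => disp s w i), hw']
  inv_mem' := by
    rintro w ⟨hw, hw'⟩
    have hv : ∀ m, w⁻¹ (m + s) = w⁻¹ m + s := by
      intro m
      apply w.injective
      rw [hw]; simp
    refine ⟨hv, ?_⟩
    rw [sum_disp] at *
    have h : ∀ i : ZMod s, disp s (fun m => w ((w⁻¹ : Equiv.Perm ℤ) m)) i
        = disp s w (i + (disp s (w⁻¹ : Equiv.Perm ℤ) i : ZMod s)) + disp s (w⁻¹ : Equiv.Perm ℤ) i :=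
      fun i => disp_mul hw i
    have h0 : ∀ i : ZMod s, disp s (fun m => w ((w⁻¹ : Equiv.Perm ℤ) m)) i = 0 := fun i => by simp [disp]
    have h1 : ∑ i : ZMod s, (disp s w (i + (disp s (w⁻¹ : Equiv.Perm ℤ) i : ZMod s))
        + disp s (w⁻¹ : Equiv.Perm ℤ) i) = 0 :=
      Finset.sum_eq_zero fun i _ => by rw [← h, h0]
    rw [Finset.sum_add_distrib,
      (residue_bijective w⁻¹ hv).sum_comp (fun i => disp s w i), hw', zero_add] at h1
    exact h1

instance neZero_of_fact (s : ℕ) [h : Fact (1 < s)] : NeZero s := ⟨by have := h.out; omega⟩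

/-- The underlying function of the generator `w_i`, `i ∈ ℤ/sℤ`. -/
def genFun (s : ℕ) (i : ZMod s) (m : ℤ) : ℤ :=
  if (m : ZMod s) = i - 1 then m + 1 else if (m : ZMod s) = i then m - 1 else m

theorem genFun_involutive (s : ℕ) [Fact (1 < s)] (i : ZMod s) :
    Function.Involutive (genFun s i) := by
  intro m
  have h1 : i ≠ i - 1 := fun h => one_ne_zero (sub_eq_self.1 h.symm)
  unfold genFun
  by_cases h : (m : ZMod s) = i - 1
  · simp [h, h1]
  · by_cases h' : (m : ZMod s) = i
    · simp [h', h1]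
    · simp [h, h']

theorem genFun_sum (s : ℕ) [Fact (1 < s)] (i : ZMod s) : ∑ j : ZMod s, disp s (genFun s i) j = 0 := by
  have h1 : i ≠ i - 1 := fun h => one_ne_zero (sub_eq_self.1 h.symm)
  have h : ∀ j : ZMod s, disp s (genFun s i) j
      = (if j = i - 1 then 1 else 0) + (if j = i then -1 else 0) := by
    intro j
    have hc : (((j.val : ℕ) : ℤ) : ZMod s) = j := by simp
    unfold disp genFun
    rw [hc]
    by_cases h : j = i - 1
    · subst h; simp
    · by_cases h' : j = i
      · simp [h', h1]
      · simp [h, h']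
  simp [h, Finset.sum_add_distrib]

/-- The generator `w_i` of the affine symmetric group: it sends `m` to `m + 1` if `m ∈ i - 1`,
to `m - 1` if `m ∈ i`, and fixes all other `m`. -/
def gen (s : ℕ) [Fact (1 < s)] (i : ZMod s) : affineSymm s :=
  ⟨(genFun_involutive s i).toPerm, by
    refine ⟨fun m => ?_, (sum_disp (s := s) (genFun s i)).2 (genFun_sum s i)⟩
    simp only [Function.Involutive.coe_toPerm, genFun, Int.cast_add, Int.cast_natCast,
      ZMod.natCast_self, add_zero]
    split_ifs <;> ring⟩

/-! ### The affine hyperoctahedral group -/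

/-- The element `v_i`, where `u = ⌊s/2⌋`: `w_0` for `i = 0`, `w_i w_{-i} w_i` for `i = ±u`,
and `w_i w_{-i}` for the remaining `i`, that is for `i = ±l` with `1 ≤ l < u`. -/
def hypGen (s : ℕ) [Fact (1 < s)] (i : ZMod s) : affineSymm s :=
  if i = 0 then gen s i
  else if i = ((s / 2 : ℕ) : ZMod s) ∨ i = -((s / 2 : ℕ) : ZMod s) then
    gen s i * gen s (-i) * gen s i
  else gen s i * gen s (-i)

/-- The affine hyperoctahedral group, as the subgroup of the affine symmetric group of degree `s`
generated by the elements `v_i`. -/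
def hyp (s : ℕ) [Fact (1 < s)] : Subgroup (affineSymm s) :=
  Subgroup.closure (Set.range (hypGen s))

/-! ### The level `t` action on the integers -/

/-- `(s - 1)(t - 1) / 2`; the division is exact for coprime `s, t ≥ 1`. -/
def shift (s t : ℕ) : ℕ := (s - 1) * (t - 1) / 2

/-- `m ↦ m + t (w a - a)`, where `a t ≡ m + shift s t` modulo `s`. -/
def levelFun (s t : ℕ) (w : ℤ → ℤ) (m : ℤ) : ℤ :=
  m + t * disp s w ((t : ZMod s)⁻¹ * ((m : ZMod s) + (shift s t : ZMod s)))

theorem inv_mul_self {s t : ℕ} (hst : s.Coprime t) : (t : ZMod s)⁻¹ * (t : ZMod s) = 1 := by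
  rw [mul_comm]; exact ZMod.coe_mul_inv_eq_one t hst.symm

theorem levelFun_mul {s t : ℕ} [NeZero s] (hst : s.Coprime t) {w : ℤ → ℤ} (v : ℤ → ℤ)
    (hw : ∀ m, w (m + s) = w m + s) (m : ℤ) :
    levelFun s t (fun m => w (v m)) m = levelFun s t w (levelFun s t v m) := by
  have h := inv_mul_self hst
  simp only [levelFun]
  rw [disp_mul hw]
  set j := (t : ZMod s)⁻¹ * ((m : ZMod s) + (shift s t : ZMod s)) with hj
  have e : (t : ZMod s)⁻¹ * (((m + t * disp s v j : ℤ) : ZMod s) + (shift s t : ZMod s))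
      = j + (disp s v j : ZMod s) := by
    push_cast
    calc _ = j + ((t : ZMod s)⁻¹ * (t : ZMod s)) * (disp s v j : ZMod s) := by rw [hj]; ring
      _ = _ := by rw [h, one_mul]
  rw [e]; ring

/-- The level `t` action of the affine symmetric group on `ℤ`. It is the homomorphism whose values
at the generators `w_i` are given in `levelInt_gen`. -/
def levelInt (s t : ℕ) [NeZero s] (hst : s.Coprime t) : affineSymm s →* Equiv.Perm ℤ :=
  MonoidHom.toHomPerm
    { toFun := fun w => (levelFun s t w.1 : Function.End ℤ)
      map_one' := by
        funext m
        change levelFun s t (fun m => m) m = m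
        simp [levelFun, disp]
      map_mul' := by
        intro w v
        funext m
        exact levelFun_mul hst v.1 w.2.1 m }

theorem levelInt_apply {s t : ℕ} [NeZero s] (hst : s.Coprime t) (w : affineSymm s) (m : ℤ) :
    levelInt s t hst w m = levelFun s t w.1 m := rfl

/-- The defining formula of the level `t` action on generators: `w_i` sends `m` to `m + t` if
`m ∈ (i - 1) t - c`, to `m - t` if `m ∈ i t - c`, and fixes all other `m`, where
`c = (s - 1)(t - 1) / 2`. -/
theorem levelInt_gen (s t : ℕ) [Fact (1 < s)] (hst : s.Coprime t) (i : ZMod s) (m : ℤ) :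
    levelInt s t hst (gen s i) m =
      if (m : ZMod s) = (i - 1) * t - shift s t then m + t
      else if (m : ZMod s) = i * t - shift s t then m - t
      else m := by
  have h := inv_mul_self hst
  have e : ∀ x : ZMod s, (t : ZMod s)⁻¹ * ((m : ZMod s) + (shift s t : ZMod s)) = x ↔
      (m : ZMod s) = x * t - shift s t := by
    intro x
    constructor
    · rintro rfl
      linear_combination (-(m : ZMod s) - (shift s t : ZMod s)) * h
    · intro hx
      rw [hx]
      linear_combination x * h
  rw [levelInt_apply]
  simp only [levelFun, ← e]
  set j := (t : ZMod s)⁻¹ * ((m : ZMod s) + (shift s t : ZMod s))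
  have hc : (((j.val : ℕ) : ℤ) : ZMod s) = j := by simp
  have hd : disp s (gen s i).1 j = genFun s i (j.val : ℤ) - (j.val : ℤ) := rfl
  rw [hd, genFun, hc]
  split_ifs <;> ring

theorem levelInt_mem {s t : ℕ} [NeZero s] (hst : s.Coprime t) (w : affineSymm s) :
    levelInt s t hst w ∈ affineSymm s := by
  have hp : ∀ m, levelInt s t hst w (m + s) = levelInt s t hst w m + s := by
    intro m
    simp only [levelInt_apply, levelFun, Int.cast_add, Int.cast_natCast, ZMod.natCast_self,
      add_zero]
    ring
  refine ⟨hp, ?_⟩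
  rw [sum_disp]
  have hw := (sum_disp _).1 w.2.2
  have hb : Function.Bijective
      (fun i : ZMod s => (t : ZMod s)⁻¹ * (i + (shift s t : ZMod s))) := by
    rw [← Finite.injective_iff_bijective]
    intro i j hij
    have h := inv_mul_self hst
    simp only at hij
    linear_combination (t : ZMod s) * hij + (j - i) * h
  have : ∀ i : ZMod s, disp s (levelInt s t hst w) i
      = t * disp s w.1 ((t : ZMod s)⁻¹ * (i + (shift s t : ZMod s))) := by
    intro i
    have hc : (((i.val : ℕ) : ℤ) : ZMod s) = i := by simp
    rw [disp, levelInt_apply, levelFun, hc]; ring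
  simp only [this]
  rw [← Finset.mul_sum, hb.sum_comp (fun i => disp s w.1 i), hw, mul_zero]

/-! ### Partitions and beta-sets -/

/-- The beta-set `{λ_r - r : r ≥ 1}` of a partition (rows of a `YoungDiagram` are numbered
from `0`). -/
def betaSet (lam : YoungDiagram) : Set ℤ :=
  Set.range fun r : ℕ => (lam.rowLen r : ℤ) - (r + 1)

theorem betaSet_strictMono (lam : YoungDiagram) :
    StrictMono fun r : ℕ => ((r : ℤ) + 1 - lam.rowLen r) := by
  apply strictMono_nat_of_lt_succ
  intro r
  have := lam.rowLen_anti r (r + 1) (by omega)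
  push_cast
  omega

theorem betaSet_injective : Function.Injective betaSet := by
  intro lam mu h
  have h' : Set.range (fun r : ℕ => ((r : ℤ) + 1 - lam.rowLen r))
      = Set.range (fun r : ℕ => ((r : ℤ) + 1 - mu.rowLen r)) := by
    have e : ∀ nu : YoungDiagram, Set.range (fun r : ℕ => ((r : ℤ) + 1 - nu.rowLen r))
        = (fun z => -z) '' betaSet nu := by
      intro nu
      unfold betaSet
      rw [← Set.range_comp]
      congr 1
      funext r
      simp
    rw [e, e, h]
  have h2 := (StrictMono.range_inj (betaSet_strictMono lam) (betaSet_strictMono mu)).1 h'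
  apply YoungDiagram.ext
  ext ⟨r, c⟩
  have h3 : (r : ℤ) + 1 - lam.rowLen r = (r : ℤ) + 1 - mu.rowLen r := congrFun h2 r
  rw [YoungDiagram.mem_cells, YoungDiagram.mem_cells, YoungDiagram.mem_iff_lt_rowLen,
    YoungDiagram.mem_iff_lt_rowLen]
  omega

/-- `B` contains every integer below `-N` and exactly `N` other integers. This holds for some `N`
if and only if `B` is the beta-set of a partition. -/
def Charged (B : Set ℤ) (N : ℕ) : Prop :=
  (∀ m : ℤ, m < -N → m ∈ B) ∧ ∃ F : Finset ℤ, (∀ m, m ∈ F ↔ m ∈ B ∧ -(N : ℤ) ≤ m) ∧ F.card = N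

theorem Charged.mono {B : Set ℤ} {N M : ℕ} (h : Charged B N) (hNM : N ≤ M) : Charged B M := by
  obtain ⟨h1, F, h2, h3⟩ := h
  refine ⟨fun m hm => h1 m (by omega), F ∪ Finset.Ico (-(M : ℤ)) (-(N : ℤ)), ?_, ?_⟩
  · intro m
    rw [Finset.mem_union, h2, Finset.mem_Ico]
    constructor
    · rintro (⟨h, h'⟩ | ⟨h, h'⟩)
      · exact ⟨h, by omega⟩
      · exact ⟨h1 m h', h⟩
    · rintro ⟨h, h'⟩
      by_cases hm : m < -(N : ℤ)
      · exact Or.inr ⟨h', hm⟩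
      · exact Or.inl ⟨h, by omega⟩
  · rw [Finset.card_union_of_disjoint, h3, Int.card_Ico]
    · omega
    · rw [Finset.disjoint_left]
      intro m hm hm'
      have := (h2 m).1 hm
      rw [Finset.mem_Ico] at hm'
      omega

theorem charged_betaSet (lam : YoungDiagram) : Charged (betaSet lam) (lam.colLen 0) := by
  have h0 : ∀ r, lam.colLen 0 ≤ r → lam.rowLen r = 0 := by
    intro r hr
    by_contra h
    have : (r, 0) ∈ lam := YoungDiagram.mem_iff_lt_rowLen.2 (by omega)
    have := YoungDiagram.mem_iff_lt_colLen.1 this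
    omega
  refine ⟨?_, (Finset.range (lam.colLen 0)).image
    (fun r : ℕ => (lam.rowLen r : ℤ) - (r + 1)), ?_, ?_⟩
  · intro m hm
    refine ⟨(-m - 1).toNat, ?_⟩
    simp only
    rw [h0 _ (by omega)]
    omega
  · intro m
    simp only [Finset.mem_image, Finset.mem_range, betaSet, Set.mem_range]
    constructor
    · rintro ⟨r, hr, rfl⟩
      exact ⟨⟨r, rfl⟩, by omega⟩
    · rintro ⟨⟨r, rfl⟩, h⟩
      refine ⟨r, ?_, rfl⟩
      by_contra hr
      rw [h0 r (by omega)] at h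
      omega
  · rw [Finset.card_image_of_injective, Finset.card_range]
    intro a b hab
    apply (betaSet_strictMono lam).injective
    simp only at hab ⊢
    omega

/-- The partition with parts `f 0 ≥ f 1 ≥ ⋯`. -/
def ofParts (f : ℕ → ℕ) (hf : Antitone f) (N : ℕ) : YoungDiagram where
  cells := (Finset.range N ×ˢ Finset.range (f 0)).filter fun x => x.2 < f x.1
  isLowerSet := by
    rintro ⟨a, b⟩ ⟨c, d⟩ ⟨h1, h2⟩ h
    simp only [Finset.coe_filter, Finset.mem_product, Finset.mem_range, Set.mem_ofPred_eq] at h h1 h2 ⊢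
    have := hf h1
    omega

theorem rowLen_ofParts (f : ℕ → ℕ) (hf : Antitone f) (N : ℕ) (hN : ∀ r, N ≤ r → f r = 0) (r : ℕ) :
    (ofParts f hf N).rowLen r = f r := by
  have key : ∀ c, c < (ofParts f hf N).rowLen r ↔ c < f r := by
    intro c
    rw [← YoungDiagram.mem_iff_lt_rowLen, ← YoungDiagram.mem_cells]
    simp only [ofParts, Finset.mem_filter, Finset.mem_product, Finset.mem_range]
    constructor
    · exact fun h => h.2
    · intro h
      refine ⟨⟨?_, lt_of_lt_of_le h (hf (Nat.zero_le r))⟩, h⟩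
      by_contra hr
      rw [hN r (by omega)] at h
      omega
  have h1 := key (f r)
  have h2 := key ((ofParts f hf N).rowLen r)
  omega

theorem exists_of_charged {B : Set ℤ} {N : ℕ} (h : Charged B N) :
    ∃ lam : YoungDiagram, betaSet lam = B := by
  obtain ⟨h1, F, h2, h3⟩ := h
  set e := F.orderEmbOfFin h3 with he
  have emem : ∀ i, e i ∈ B ∧ -(N : ℤ) ≤ e i := fun i => (h2 _).1 (F.orderEmbOfFin_mem h3 i)
  -- the element of `B` at position `r` in decreasing order
  let b : ℕ → ℤ := fun r => if h : r < N then e ⟨N - 1 - r, by omega⟩ else -r - 1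
  have hbstep : ∀ r, b (r + 1) < b r := by
    intro r
    simp only [b]
    by_cases hr : r + 1 < N
    · rw [dif_pos hr, dif_pos (by omega)]
      apply e.strictMono
      rw [Fin.lt_def]
      simp only
      omega
    · rw [dif_neg hr]
      by_cases hr' : r < N
      · rw [dif_pos hr']
        have := (emem ⟨N - 1 - r, by omega⟩).2
        push_cast
        omega
      · rw [dif_neg hr']
        push_cast
        omega
  have htail : ∀ r, N ≤ r → b r = -r - 1 := fun r hr => by simp [b, not_lt.2 hr]
  have hanti : Antitone fun r : ℕ => b r + r + 1 := by
    apply antitone_nat_of_succ_le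
    intro r
    have := hbstep r
    push_cast
    omega
  have hnn : ∀ r : ℕ, 0 ≤ b r + r + 1 := by
    intro r
    have h := hanti (le_max_left r N)
    have h' := htail _ (le_max_right r N)
    simp only at h
    omega
  refine ⟨ofParts (fun r => (b r + r + 1).toNat)
    (fun i j hij => Int.toNat_le_toNat (hanti hij)) N, ?_⟩
  have hbeta : ∀ r : ℕ, ((b r + r + 1).toNat : ℤ) - (r + 1) = b r := by
    intro r
    have := hnn r
    omega
  unfold betaSet
  have hrow := rowLen_ofParts (fun r => (b r + r + 1).toNat)
    (fun i j hij => Int.toNat_le_toNat (hanti hij)) N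
    (fun r hr => by rw [htail r hr]; omega)
  simp only [hrow, hbeta]
  ext m
  constructor
  · rintro ⟨r, rfl⟩
    change b r ∈ B
    by_cases hr : r < N
    · simp only [b, dif_pos hr]
      exact (emem _).1
    · rw [htail r (by omega)]
      exact h1 _ (by omega)
  · intro hm
    by_cases hmN : m < -(N : ℤ)
    · refine ⟨(-m - 1).toNat, ?_⟩
      change b (-m - 1).toNat = m
      rw [htail _ (by omega)]
      omega
    · have hF : m ∈ (F : Set ℤ) := (h2 m).2 ⟨hm, by omega⟩
      rw [← F.range_orderEmbOfFin h3] at hF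
      obtain ⟨i, hi⟩ := hF
      have hi' := i.2
      refine ⟨N - 1 - i, ?_⟩
      simp only [b]
      rw [dif_pos (by omega)]
      rw [← hi]
      congr 1
      ext
      simp only
      omega

theorem sum_ediv {s : ℕ} [NeZero s] (x : affineSymm s) :
    ∑ r ∈ Finset.range s, x.1 (r : ℤ) / s = 0 := by
  have hs : (s : ℤ) ≠ 0 := by exact_mod_cast NeZero.ne s
  have h1 : ∑ r ∈ Finset.range s, x.1 (r : ℤ) % s = (s.choose 2 : ℕ) := by
    rw [← sum_zmod (fun r => x.1 (r : ℤ) % s), ← sum_range_cast, ← sum_zmod (fun r => (r : ℤ)),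
      ← (residue_bijective x.1 x.2.1).sum_comp (fun i : ZMod s => (i.val : ℤ))]
    refine Finset.sum_congr rfl fun i _ => ?_
    have : i + (disp s x.1 i : ZMod s) = ((x.1 (i.val : ℤ) : ℤ) : ZMod s) := by simp [disp]
    rw [this, ZMod.val_intCast]
  have h2 : ∑ r ∈ Finset.range s, x.1 (r : ℤ)
      = s * (∑ r ∈ Finset.range s, x.1 (r : ℤ) / s) + ∑ r ∈ Finset.range s, x.1 (r : ℤ) % s := by
    rw [Finset.mul_sum, ← Finset.sum_add_distrib]
    exact Finset.sum_congr rfl fun r _ => (Int.mul_ediv_add_emod _ _).symm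
  rw [h1, x.2.2] at h2
  have h3 : (s : ℤ) * (∑ r ∈ Finset.range s, x.1 (r : ℤ) / s) = 0 := by linarith
  exact (mul_eq_zero.1 h3).resolve_left hs

theorem exists_bound {s : ℕ} [NeZero s] (x : affineSymm s) :
    ∃ D : ℕ, ∀ m : ℤ, |x.1 m - m| ≤ D := by
  refine ⟨∑ i : ZMod s, (disp s x.1 i).natAbs, fun m => ?_⟩
  rw [← disp_cast x.2.1]
  have := Finset.single_le_sum (f := fun i : ZMod s => (disp s x.1 i).natAbs)
    (fun i _ => Nat.zero_le _) (Finset.mem_univ (m : ZMod s))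
  have h2 : (disp s x.1 (m : ZMod s)).natAbs ≤ ∑ i : ZMod s, (disp s x.1 i).natAbs := this
  rw [Int.abs_eq_natAbs]
  exact_mod_cast h2

theorem card_below {s : ℕ} [NeZero s] (x : affineSymm s) (D : ℕ) (hD : ∀ m : ℤ, |x.1 m - m| ≤ D) :
    ((Finset.Ico (0 : ℤ) (s * D + D)).filter fun b => x.1 b < s * D).card = s * D := by
  have hs : 0 < (s : ℤ) := by exact_mod_cast Nat.pos_of_ne_zero (NeZero.ne s)
  rw [Finset.card_eq_sum_card_fiberwise (f := fun b : ℤ => (b % s).toNat) (t := Finset.range s)]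
  · have hfib : ∀ r ∈ Finset.range s,
        (((Finset.Ico (0 : ℤ) (s * D + D)).filter fun b => x.1 b < s * D).filter
          fun b : ℤ => (b % s).toNat = r).card = (D - x.1 (r : ℤ) / s).toNat := by
      intro r hr
      have hr' : (r : ℤ) < s := by exact_mod_cast Finset.mem_range.1 hr
      have hlt : ∀ k : ℤ, x.1 (r + s * k) < s * D ↔ k < D - x.1 (r : ℤ) / s := by
        intro k
        rw [periodic_mul x.2.1, lt_sub_iff_add_lt, add_comm k, ← Int.add_mul_ediv_left _ _ hs.ne',
          Int.ediv_lt_iff_lt_mul hs, mul_comm (D : ℤ)]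
      have : ((Finset.Ico (0 : ℤ) (s * D + D)).filter fun b => x.1 b < s * D).filter
          (fun b : ℤ => (b % s).toNat = r)
          = (Finset.range (D - x.1 (r : ℤ) / s).toNat).image (fun k : ℕ => (r : ℤ) + s * k) := by
        ext b
        simp only [Finset.mem_filter, Finset.mem_Ico, Finset.mem_image, Finset.mem_range]
        constructor
        · rintro ⟨⟨⟨hb0, hb1⟩, hb2⟩, hb3⟩
          have hm := Int.emod_nonneg b hs.ne'
          have hd := Int.ediv_nonneg hb0 hs.le
          have hb := Int.mul_ediv_add_emod b s
          have hbr : b = r + s * ((b / s).toNat : ℕ) := by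
            rw [Int.toNat_of_nonneg hd]
            omega
          refine ⟨(b / s).toNat, ?_, hbr.symm⟩
          rw [hbr, hlt] at hb2
          omega
        · rintro ⟨k, hk, rfl⟩
          have hk' : x.1 (r + s * (k : ℤ)) < s * D := (hlt k).2 (by omega)
          have := abs_le.1 (hD (r + s * (k : ℤ)))
          refine ⟨⟨⟨by positivity, by omega⟩, hk'⟩, ?_⟩
          rw [Int.add_mul_emod_self_left, Int.emod_eq_of_lt (by omega) hr']
          simp
      rw [this, Finset.card_image_of_injective, Finset.card_range]
      intro a b hab
      have hab' : (s : ℤ) * a = s * b := by simpa using hab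
      exact_mod_cast mul_left_cancel₀ hs.ne' hab'
    rw [Finset.sum_congr rfl hfib]
    have hnn : ∀ r ∈ Finset.range s, (((D - x.1 (r : ℤ) / s).toNat : ℕ) : ℤ)
        = D - x.1 (r : ℤ) / s := by
      intro r hr
      have hr' : (r : ℤ) < s := by exact_mod_cast Finset.mem_range.1 hr
      apply Int.toNat_of_nonneg
      have h1 := abs_le.1 (hD r)
      have h2 : x.1 (r : ℤ) / s < D + 1 := by
        rw [Int.ediv_lt_iff_lt_mul hs]
        nlinarith
      omega
    have : ((∑ r ∈ Finset.range s, (D - x.1 (r : ℤ) / s).toNat : ℕ) : ℤ) = (s * D : ℕ) := by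
      push_cast
      rw [Finset.sum_congr rfl hnn, Finset.sum_sub_distrib, sum_ediv]
      simp
    exact_mod_cast this
  · intro b _
    have hm := Int.emod_nonneg b hs.ne'
    have hl := Int.emod_lt_of_pos b hs
    simp only [Finset.coe_range, Set.mem_Iio]
    omega

theorem charged_image {s : ℕ} [NeZero s] (x : affineSymm s) {B : Set ℤ} {N : ℕ}
    (h : Charged B N) : ∃ P, Charged (x.1 '' B) P := by
  obtain ⟨D, hD⟩ := exists_bound x
  have hD' : ∀ m : ℤ, x.1 m - m ≤ D ∧ -(D : ℤ) ≤ x.1 m - m := fun m =>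
    ⟨(abs_le.1 (hD m)).2, (abs_le.1 (hD m)).1⟩
  have hs1 : 1 ≤ s := Nat.pos_of_ne_zero (NeZero.ne s)
  obtain ⟨P, hP1, hP2⟩ : ∃ P, N + D ≤ P ∧ P = s * (N + D) := ⟨s * (N + D), by nlinarith, rfl⟩
  obtain ⟨T, hT1, hT2⟩ : ∃ T, D ≤ T ∧ T = s * D := ⟨s * D, by nlinarith, rfl⟩
  have hcard := card_below x D hD
  have hTz : (T : ℤ) = s * D := by rw [hT2]; push_cast; rfl
  rw [← hTz, ← hT2] at hcard
  have hshift : ∀ b : ℤ, x.1 (b - (P + T : ℕ)) = x.1 b - (P + T : ℕ) := by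
    intro b
    have := periodic_mul x.2.1 b (-((N + D : ℕ) + (D : ℕ) : ℤ))
    have e : (s : ℤ) * (-((N + D : ℕ) + (D : ℕ) : ℤ)) = -(P + T : ℕ) := by
      rw [hP2, hT2]; push_cast; ring
    rw [e] at this
    exact this
  obtain ⟨F, hF1, hF2⟩ := (h.mono (show N ≤ P + T by omega)).2
  refine ⟨P, ?_, (F.filter fun b => -(P : ℤ) ≤ x.1 b).image x.1, ?_, ?_⟩
  · intro m hm
    refine ⟨x.1.symm m, h.1 _ ?_, by simp⟩
    have := hD' (x.1.symm m)
    rw [Equiv.apply_symm_apply] at this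
    omega
  · intro m
    simp only [Finset.mem_image, Finset.mem_filter, hF1, Set.mem_image]
    constructor
    · rintro ⟨b, ⟨⟨hb, _⟩, hb'⟩, rfl⟩
      exact ⟨⟨b, hb, rfl⟩, hb'⟩
    · rintro ⟨⟨b, hb, rfl⟩, hb'⟩
      have := hD' b
      exact ⟨b, ⟨⟨hb, by push_cast; omega⟩, hb'⟩, rfl⟩
  · rw [Finset.card_image_of_injective _ x.1.injective]
    have hsplit := Finset.card_filter_add_card_filter_not (s := F) (fun b => -(P : ℤ) ≤ x.1 b)
    have hneg : (F.filter fun b => ¬ -(P : ℤ) ≤ x.1 b)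
        = ((Finset.Ico (0 : ℤ) (T + D)).filter fun b => x.1 b < T).image
          (fun b : ℤ => b - (P + T : ℕ)) := by
      ext b
      simp only [Finset.mem_filter, Finset.mem_image, Finset.mem_Ico, hF1]
      constructor
      · rintro ⟨⟨_, hb1⟩, hb2⟩
        have e := hshift (b + (P + T : ℕ))
        rw [add_sub_cancel_right] at e
        have := hD' b
        refine ⟨b + (P + T : ℕ), ⟨⟨by omega, ?_⟩, ?_⟩, by ring⟩
        · push_cast at *; omega
        · push_cast at *; omega
      · rintro ⟨a, ⟨⟨ha0, ha1⟩, ha2⟩, rfl⟩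
        have := hD' (a - (P + T : ℕ))
        rw [hshift] at *
        push_cast at *
        exact ⟨⟨h.1 _ (by omega), by omega⟩, by omega⟩
    rw [hneg, Finset.card_image_of_injective _ (sub_left_injective), hcard, hF2] at hsplit
    omega

/-- The image of a beta-set under an element of the affine symmetric group is a beta-set. -/
theorem exists_betaSet_image {s : ℕ} [NeZero s] {x : Equiv.Perm ℤ} (hx : x ∈ affineSymm s)
    (lam : YoungDiagram) : ∃ mu : YoungDiagram, betaSet mu = x '' betaSet lam := by
  obtain ⟨P, hP⟩ := charged_image ⟨x, hx⟩ (charged_betaSet lam)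
  exact exists_of_charged hP

/-! ### The level `t` action on partitions -/

/-- The level `t` action of the affine symmetric group on partitions, determined by
`betaSet_levelPart`. -/
noncomputable def levelPart (s t : ℕ) [NeZero s] (hst : s.Coprime t) :
    affineSymm s →* Equiv.Perm YoungDiagram :=
  MonoidHom.toHomPerm
    { toFun := fun w => ((fun lam => Classical.choose
        (exists_betaSet_image (levelInt_mem hst w) lam)) : Function.End YoungDiagram)
      map_one' := by
        funext lam
        apply betaSet_injective
        refine (Classical.choose_spec (exists_betaSet_image (levelInt_mem hst 1) lam)).trans ?_
        rw [map_one]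
        exact Set.image_id _
      map_mul' := by
        intro w v
        funext lam
        apply betaSet_injective
        refine (Classical.choose_spec (exists_betaSet_image (levelInt_mem hst (w * v)) lam)).trans ?_
        refine Eq.trans ?_ (Classical.choose_spec (exists_betaSet_image (levelInt_mem hst w) _)).symm
        rw [Classical.choose_spec (exists_betaSet_image (levelInt_mem hst v) lam), map_mul,
          Set.image_image]
        rfl }

theorem betaSet_levelPart (s t : ℕ) [NeZero s] (hst : s.Coprime t) (w : affineSymm s)
    (lam : YoungDiagram) :
    betaSet (levelPart s t hst w lam) = levelInt s t hst w '' betaSet lam :=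
  Classical.choose_spec (exists_betaSet_image (levelInt_mem hst w) lam)

/-- The orbit of `lam` under the level `t` action of the affine hyperoctahedral group. -/
def hypOrbit (s t : ℕ) [Fact (1 < s)] (hst : s.Coprime t) (lam : YoungDiagram) :
    Set YoungDiagram :=
  {mu | ∃ v ∈ hyp s, levelPart s t hst v lam = mu}

/-! ### Rim hooks and cores -/

/-- The rim hook of `lam` at the cell `c`: all cells weakly below and weakly to the right of `c`
whose diagonal successor is not in `lam`. -/
def rimHook (lam : YoungDiagram) (c : ℕ × ℕ) : Finset (ℕ × ℕ) :=
  lam.cells.filter fun x => c.1 ≤ x.1 ∧ c.2 ≤ x.2 ∧ (x.1 + 1, x.2 + 1) ∉ lam.cells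

/-- The hook length of `lam` at the cell `c`: the size of the rim hook at `c`. -/
def hookLength (lam : YoungDiagram) (c : ℕ × ℕ) : ℕ := (rimHook lam c).card

/-- `lam` is an `s`-core: none of its hook lengths equals `s`. -/
def IsCore (s : ℕ) (lam : YoungDiagram) : Prop := ∀ c ∈ lam, hookLength lam c ≠ s

/-- `mu` is obtained from `lam` by removing a rim hook of length `t`. -/
def RemovesHook (t : ℕ) (lam mu : YoungDiagram) : Prop :=
  ∃ c ∈ lam, hookLength lam c = t ∧ mu.cells = lam.cells \ rimHook lam c

/-- `nu` is a `t`-core of `lam`: a `t`-core obtained from `lam` by repeatedly removing rim hooks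
of length `t`. -/
def IsCoreOf (t : ℕ) (nu lam : YoungDiagram) : Prop :=
  Relation.ReflTransGen (RemovesHook t) lam nu ∧ IsCore t nu

/-- The set of self-conjugate `s`-cores. -/
def scCores (s : ℕ) : Set YoungDiagram := {lam | lam.transpose = lam ∧ IsCore s lam}

end SCCore

namespace SCCore

/-! ### Beta-sets, hooks and conjugation -/

/-! Read the beta-set as beads on `ℤ`, a missing integer being a gap. Removing a rim hook of length
`t` moves one bead from `m` to the gap `m - t` (`betaSet_of_removesHook`). It therefore changes the
beta-set by a finitely supported permutation preserving residues modulo `t` (`SameCharges`). A set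
closed under `m ↦ m - t` is determined by this equivalence (`SameCharges.eq`), so `t`-cores are
unique. The level `t` action also preserves the equivalence, since each generator moves integers by
`0` or `±t` (`sameCharges_levelPart`). Hence partitions in one orbit have the same `t`-core.

For the converse, encode an `s`-core by its first gaps `q i` in the residue classes `i t - c` modulo
`s`. In these coordinates `w_i` exchanges `q (i - 1)` and `q i` up to a shift by `t`. Conjugation
becomes a reflection along `i ↦ -1 - i`, which turns `w_i` into `w_{-i}`, so each `v_i` commutes
with it, by commutation or a braid relation. If the core is not a `t`-core, some gap `q i - q (i -
1)` exceeds `t`, and then `v_i` strictly lowers `∑ (q i)²` (`exists_isEnds_hypGen`). Descent reaches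
a `t`-core inside the orbit; by invariance of charges it is the `t`-core of the original partition.
-/

theorem lt_rowLen_iff_lt_colLen (lam : YoungDiagram) (r c : ℕ) :
    c < lam.rowLen r ↔ r < lam.colLen c := by
  rw [← YoungDiagram.mem_iff_lt_rowLen, YoungDiagram.mem_iff_lt_colLen]

/-- Each integer labels one step of the boundary path of the diagram: rows give the beads, columns
give the gaps. -/
theorem notMem_betaSet_iff (lam : YoungDiagram) (n : ℤ) :
    n ∉ betaSet lam ↔ ∃ c : ℕ, (c : ℤ) - lam.colLen c = n := by
  constructor
  · intro hn
    have hex : ∃ r : ℕ, (lam.rowLen r : ℤ) - (r + 1) ≤ n := by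
      refine ⟨lam.rowLen 0 + n.natAbs, ?_⟩
      have := lam.rowLen_anti 0 (lam.rowLen 0 + n.natAbs) (Nat.zero_le _)
      omega
    classical
    -- The first row whose bead is at most `n`. A gap at `n` then belongs to the column `n + r`,
    -- which has length exactly `r`.
    let r := Nat.find hex
    have hr : (lam.rowLen r : ℤ) - (r + 1) ≤ n := Nat.find_spec hex
    have hne : (lam.rowLen r : ℤ) - (r + 1) ≠ n := fun h => hn ⟨r, h⟩
    obtain ⟨c, hc⟩ : ∃ c : ℕ, (c : ℤ) = n + r := ⟨(n + r).toNat, by omega⟩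
    refine ⟨c, ?_⟩
    have h1 : ¬ r < lam.colLen c := by
      rw [← lt_rowLen_iff_lt_colLen]
      omega
    have h2 : ∀ k, k < r → k < lam.colLen c := by
      intro k hk
      rw [← lt_rowLen_iff_lt_colLen]
      have h3 := Nat.find_min hex (m := r - 1) (by omega)
      have h4 := lam.rowLen_anti k (r - 1) (by omega)
      omega
    have h5 : lam.colLen c = r := by
      rcases Nat.eq_zero_or_pos r with h0 | h0
      · omega
      · have := h2 (r - 1) (by omega)
        omega
    rw [h5]
    omega
  · rintro ⟨c, rfl⟩ ⟨r, hr⟩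
    have := lt_rowLen_iff_lt_colLen lam r c
    simp only at hr
    omega

/-- Transposition turns column labels into row labels, and `c - colLen c` is the reflection under `m
↦ -1 - m` of `colLen c - (c + 1)`. -/
theorem mem_betaSet_transpose (lam : YoungDiagram) (m : ℤ) :
    m ∈ betaSet lam.transpose ↔ -1 - m ∉ betaSet lam := by
  rw [notMem_betaSet_iff]
  simp only [betaSet, Set.mem_range, YoungDiagram.rowLen_transpose]
  exact exists_congr fun c => ⟨fun h => by omega, fun h => by omega⟩

theorem transpose_eq_self_iff (lam : YoungDiagram) :
    lam.transpose = lam ↔ ∀ m, m ∈ betaSet lam ↔ -1 - m ∉ betaSet lam := by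
  rw [← betaSet_injective.eq_iff, Set.ext_iff]
  simp only [mem_betaSet_transpose]
  exact forall_congr' fun m => iff_comm

theorem mem_rimHook {lam : YoungDiagram} {r c i j : ℕ} :
    (i, j) ∈ rimHook lam (r, c) ↔
      (i, j) ∈ lam ∧ r ≤ i ∧ c ≤ j ∧ (i + 1, j + 1) ∉ lam := by
  simp [rimHook, YoungDiagram.mem_cells]

/-- The last cell of a diagram on the diagonal through a given cell. -/
theorem exists_last_on_diagonal (lam : YoungDiagram) {i j : ℕ} (h : (i, j) ∈ lam) :
    ∃ k, (i + k, j + k) ∈ lam ∧ (i + k + 1, j + k + 1) ∉ lam := by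
  by_contra! hk
  have hall : ∀ k, (i + k, j + k) ∈ lam := by
    intro k
    induction k with
    | zero => exact h
    | succ k ih => exact hk k ih
  have h1 := YoungDiagram.mem_iff_lt_rowLen.1 (hall (lam.rowLen 0))
  have h2 := lam.rowLen_anti 0 (i + lam.rowLen 0) (Nat.zero_le _)
  omega

/-- The content `j - i` is a bijection from the rim hook onto the interval between the gap of column
`c` and the bead of row `r`: each diagonal in this range has exactly one cell on the rim. -/
theorem hookLength_eq {lam : YoungDiagram} {r c : ℕ} (h : (r, c) ∈ lam) :
    (hookLength lam (r, c) : ℤ) = ((lam.rowLen r : ℤ) - (r + 1)) - (c - lam.colLen c) := by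
  have hr := YoungDiagram.mem_iff_lt_rowLen.1 h
  have hc := YoungDiagram.mem_iff_lt_colLen.1 h
  have hinj : Set.InjOn (fun x : ℕ × ℕ => (x.2 : ℤ) - x.1) (rimHook lam (r, c)) := by
    have key : ∀ i j i' j' : ℕ, (i, j) ∈ rimHook lam (r, c) → (i', j') ∈ rimHook lam (r, c) →
        (j : ℤ) - i = j' - i' → i' ≤ i := by
      intro i j i' j' hx hy hxy
      by_contra hlt
      exact (mem_rimHook.1 hx).2.2.2
        (lam.up_left_mem (by omega) (by omega) (mem_rimHook.1 hy).1)
    rintro ⟨i, j⟩ hx ⟨i', j'⟩ hy hxy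
    have h1 := key i j i' j' hx hy hxy
    have h2 := key i' j' i j hy hx hxy.symm
    simp only at hxy
    ext <;> simp only <;> omega
  have himg : (rimHook lam (r, c)).image (fun x : ℕ × ℕ => (x.2 : ℤ) - x.1)
      = Finset.Ioc ((c : ℤ) - lam.colLen c) ((lam.rowLen r : ℤ) - (r + 1)) := by
    ext d
    simp only [Finset.mem_image, Finset.mem_Ioc, Prod.exists]
    constructor
    · rintro ⟨i, j, hx, rfl⟩
      obtain ⟨hx1, hx2, hx3, -⟩ := mem_rimHook.1 hx
      have h1 := YoungDiagram.mem_iff_lt_rowLen.1 (lam.up_left_mem hx2 le_rfl hx1)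
      have h2 := YoungDiagram.mem_iff_lt_colLen.1 (lam.up_left_mem le_rfl hx3 hx1)
      omega
    · rintro ⟨hd1, hd2⟩
      -- The diagonal of content `d` meets the arm or the leg of the hook at `(r, c)`; sliding along
      -- it then reaches the rim.
      obtain ⟨i, j, hij, hi, hj, hd⟩ : ∃ i j : ℕ, (i, j) ∈ lam ∧ r ≤ i ∧ c ≤ j ∧ (j : ℤ) - i = d := by
        by_cases hdc : (c : ℤ) ≤ r + d
        · exact ⟨r, (r + d).toNat, YoungDiagram.mem_iff_lt_rowLen.2 (by omega), le_rfl,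
            by omega, by omega⟩
        · exact ⟨(c - d).toNat, c, YoungDiagram.mem_iff_lt_colLen.2 (by omega), by omega,
            le_rfl, by omega⟩
      obtain ⟨k, hk1, hk2⟩ := exists_last_on_diagonal lam hij
      exact ⟨i + k, j + k, mem_rimHook.2 ⟨hk1, by omega, by omega, hk2⟩, by push_cast; omega⟩
  rw [hookLength, ← Finset.card_image_of_injOn hinj, himg, Int.card_Ioc]
  omega

/-- The hooks of length `t` correspond to the pairs `m ∈ B`, `m - t ∉ B`. -/
theorem exists_hook_iff (lam : YoungDiagram) {t : ℕ} (ht : 0 < t) (m : ℤ) :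
    (m ∈ betaSet lam ∧ m - t ∉ betaSet lam) ↔
      ∃ r c, (r, c) ∈ lam ∧ hookLength lam (r, c) = t ∧ (lam.rowLen r : ℤ) - (r + 1) = m := by
  rw [notMem_betaSet_iff]
  constructor
  · rintro ⟨⟨r, hr⟩, c, hc⟩
    simp only at hr
    have hiff := lt_rowLen_iff_lt_colLen lam r c
    have hmem : (r, c) ∈ lam := YoungDiagram.mem_iff_lt_rowLen.2 (by omega)
    have := hookLength_eq hmem
    exact ⟨r, c, hmem, by omega, hr⟩
  · rintro ⟨r, c, hmem, hl, hr⟩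
    have := hookLength_eq hmem
    exact ⟨⟨r, hr⟩, c, by omega⟩

theorem isCore_iff (lam : YoungDiagram) {t : ℕ} (ht : 0 < t) :
    IsCore t lam ↔ ∀ m ∈ betaSet lam, m - t ∈ betaSet lam := by
  constructor
  · intro h m hm
    by_contra hn
    obtain ⟨r, c, hrc, hl, -⟩ := (exists_hook_iff lam ht m).1 ⟨hm, hn⟩
    exact h _ hrc hl
  · rintro h ⟨r, c⟩ hrc hl
    obtain ⟨h1, h2⟩ := (exists_hook_iff lam ht _).2 ⟨r, c, hrc, hl, rfl⟩
    exact h2 (h _ h1)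

/-! ### Removal of rim hooks -/

/-- The diagram left after removing the rim hook at `c`. -/
def removeRimHook (lam : YoungDiagram) (c : ℕ × ℕ) : YoungDiagram where
  cells := lam.cells \ rimHook lam c
  isLowerSet := by
    rintro ⟨i, j⟩ ⟨i', j'⟩ ⟨h1, h2⟩ h
    obtain ⟨r, c⟩ := c
    simp only [Finset.coe_sdiff, Set.mem_sdiff, Finset.mem_coe, mem_rimHook,
      YoungDiagram.mem_cells] at h h1 h2 ⊢
    refine ⟨lam.up_left_mem h1 h2 h.1, fun hx => h.2 ⟨h.1, by omega, by omega, fun hy => ?_⟩⟩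
    exact hx.2.2.2 (lam.up_left_mem (by omega) (by omega) hy)

theorem exists_removesHook {lam : YoungDiagram} {t : ℕ} (ht : 0 < t) (h : ¬ IsCore t lam) :
    ∃ mu, RemovesHook t lam mu ∧ mu.cells.card < lam.cells.card := by
  simp only [IsCore, not_forall, not_not] at h
  obtain ⟨c, hc, hl⟩ := h
  refine ⟨removeRimHook lam c, ⟨c, hc, hl, rfl⟩, ?_⟩
  have hsub : rimHook lam c ⊆ lam.cells := Finset.filter_subset _ _
  have hcard := Finset.card_sdiff_add_card_eq_card hsub
  rw [show (rimHook lam c).card = t from hl] at hcard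
  change (lam.cells \ rimHook lam c).card < _
  omega

theorem exists_isCoreOf {t : ℕ} (ht : 0 < t) (lam : YoungDiagram) : ∃ nu, IsCoreOf t nu lam := by
  induction hn : lam.cells.card using Nat.strong_induction_on generalizing lam with
  | _ n ih =>
    by_cases h : IsCore t lam
    · exact ⟨lam, .refl, h⟩
    · obtain ⟨mu, h1, h2⟩ := exists_removesHook ht h
      obtain ⟨nu, h3, h4⟩ := ih _ (hn ▸ h2) mu rfl
      exact ⟨nu, .head h1 h3, h4⟩

/-- Removing a rim hook of length `t` replaces an element `m` of the beta-set by `m - t`. -/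
theorem betaSet_of_removesHook {lam mu : YoungDiagram} {t : ℕ} (h : RemovesHook t lam mu) :
    ∃ m, m ∈ betaSet lam ∧ m - t ∉ betaSet lam ∧
      betaSet mu = Equiv.swap m (m - t) '' betaSet lam := by
  obtain ⟨⟨r, c⟩, hmem, hl, hcells⟩ := h
  have hr := YoungDiagram.mem_iff_lt_rowLen.1 hmem
  have hc := YoungDiagram.mem_iff_lt_colLen.1 hmem
  have hlen := hookLength_eq hmem
  rw [hl] at hlen
  have ht : 0 < t := by omega
  obtain ⟨h1, h2⟩ := (exists_hook_iff lam ht _).2 ⟨r, c, hmem, hl, rfl⟩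
  refine ⟨_, h1, h2, ?_⟩
  have hrow : ∀ i j, j < mu.rowLen i ↔
      j < lam.rowLen i ∧ ¬ (r ≤ i ∧ c ≤ j ∧ lam.rowLen (i + 1) ≤ j + 1) := by
    intro i j
    rw [← YoungDiagram.mem_iff_lt_rowLen, ← YoungDiagram.mem_cells, hcells, Finset.mem_sdiff,
      mem_rimHook, YoungDiagram.mem_cells, YoungDiagram.mem_iff_lt_rowLen,
      YoungDiagram.mem_iff_lt_rowLen]
    constructor
    · rintro ⟨h, h'⟩
      exact ⟨h, fun hx => h' ⟨h, hx.1, hx.2.1, by omega⟩⟩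
    · rintro ⟨h, h'⟩
      exact ⟨h, fun hx => h' ⟨hx.2.1, hx.2.2.1, by omega⟩⟩
  have hout : ∀ i, i < r ∨ lam.colLen c ≤ i → mu.rowLen i = lam.rowLen i := by
    intro i hi
    have hic := lt_rowLen_iff_lt_colLen lam i c
    have e1 := hrow i (mu.rowLen i)
    have e2 := hrow i (lam.rowLen i)
    have e3 := hrow i (mu.rowLen i - 1)
    omega
  -- Inside the hook, row `i` becomes the old row `i + 1` shortened by one, so its bead is the old
  -- bead of row `i + 1`. Only the bead of row `r` is lost, and the last row of the hook supplies
  -- the new one.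
  have hin : ∀ i, r ≤ i → i + 1 < lam.colLen c → mu.rowLen i + 1 = lam.rowLen (i + 1) := by
    intro i hi hi'
    have hic := lt_rowLen_iff_lt_colLen lam (i + 1) c
    have hanti := lam.rowLen_anti i (i + 1) (by omega)
    have e1 := hrow i (lam.rowLen (i + 1) - 1)
    have e2 := hrow i (lam.rowLen (i + 1) - 2)
    have e3 := hrow i (mu.rowLen i)
    omega
  have hlast : mu.rowLen (lam.colLen c - 1) = c := by
    have hic := lt_rowLen_iff_lt_colLen lam (lam.colLen c - 1) c
    have hic' := lt_rowLen_iff_lt_colLen lam (lam.colLen c) c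
    have e0 : lam.colLen c - 1 + 1 = lam.colLen c := by omega
    have e1 := hrow (lam.colLen c - 1) c
    have e2 := hrow (lam.colLen c - 1) (c - 1)
    have e3 := hrow (lam.colLen c - 1) (mu.rowLen (lam.colLen c - 1))
    rw [e0] at e1 e2 e3
    omega
  set x : ℤ := (lam.rowLen r : ℤ) - (r + 1) with hx
  have hmono := betaSet_strictMono lam
  ext m
  rw [Equiv.image_eq_preimage_symm, Set.mem_preimage, Equiv.symm_swap]
  constructor
  · rintro ⟨i, rfl⟩
    simp only
    by_cases hi : i < r ∨ lam.colLen c ≤ i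
    · rw [hout i hi, Equiv.swap_apply_of_ne_of_ne]
      · exact ⟨i, rfl⟩
      · intro he
        have : i = r := hmono.injective (by omega)
        omega
      · exact fun he => h2 (he ▸ ⟨i, rfl⟩)
    · by_cases hi' : i + 1 < lam.colLen c
      · have e := hin i (by omega) hi'
        have hmem' : (mu.rowLen i : ℤ) - (i + 1) ∈ betaSet lam := ⟨i + 1, by push_cast; omega⟩
        rw [Equiv.swap_apply_of_ne_of_ne]
        · exact hmem'
        · intro he
          have : i + 1 = r := hmono.injective (by push_cast; omega)
          omega
        · exact fun he => h2 (he ▸ hmem')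
      · have e : i = lam.colLen c - 1 := by omega
        have : (mu.rowLen i : ℤ) - (i + 1) = x - t := by rw [e, hlast]; omega
        rw [this, Equiv.swap_apply_right]
        exact h1
  · intro hm
    by_cases hm1 : m = x
    · rw [hm1, Equiv.swap_apply_left] at hm
      exact absurd hm h2
    by_cases hm2 : m = x - t
    · refine ⟨lam.colLen c - 1, ?_⟩
      simp only [hlast]
      omega
    rw [Equiv.swap_apply_of_ne_of_ne hm1 hm2] at hm
    obtain ⟨i, hi⟩ := hm
    simp only at hi
    have hir : i ≠ r := by rintro rfl; omega
    by_cases hi1 : i < r ∨ lam.colLen c ≤ i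
    · exact ⟨i, by simp only [hout i hi1]; exact hi⟩
    · have e := hin (i - 1) (by omega) (by omega)
      rw [Nat.sub_add_cancel (by omega)] at e
      exact ⟨i - 1, by simp only; omega⟩

/-! ### Beta-sets with the same runner charges -/

/-- `C` is the image of `B` under a finitely supported permutation of `ℤ` that preserves
residues modulo `t`. -/
def SameCharges (t : ℕ) (B C : Set ℤ) : Prop :=
  ∃ f : Equiv.Perm ℤ, {m | f m ≠ m}.Finite ∧ (∀ m, (t : ℤ) ∣ f m - m) ∧ f '' B = C

theorem SameCharges.refl (t : ℕ) (B : Set ℤ) : SameCharges t B B :=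
  ⟨1, by simp, by simp, by simp⟩

theorem SameCharges.symm {t : ℕ} {B C : Set ℤ} (h : SameCharges t B C) : SameCharges t C B := by
  obtain ⟨f, h1, h2, rfl⟩ := h
  refine ⟨f⁻¹, h1.subset fun m hm hf => hm ?_, fun m => ?_, ?_⟩
  · rw [Equiv.Perm.inv_eq_iff_eq, hf]
  · have h := h2 (f⁻¹ m)
    rw [show f (f⁻¹ m) = m by simp] at h
    rwa [dvd_sub_comm]
  · rw [Set.image_image]
    simp

theorem SameCharges.trans {t : ℕ} {B C D : Set ℤ} (h : SameCharges t B C)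
    (h' : SameCharges t C D) : SameCharges t B D := by
  obtain ⟨f, h1, h2, rfl⟩ := h
  obtain ⟨g, h3, h4, rfl⟩ := h'
  refine ⟨g * f, (h1.union h3).subset fun m hm => ?_, fun m => ?_, ?_⟩
  · by_contra hn
    simp only [Set.mem_union, Set.mem_ofPred_eq, not_or, not_not] at hn
    exact hm (by rw [Equiv.Perm.mul_apply, hn.1, hn.2])
  · rw [Equiv.Perm.mul_apply, ← sub_add_sub_cancel _ (f m)]
    exact dvd_add (h4 _) (h2 _)
  · rw [Set.image_image]
    rfl

theorem sub_mul_mem {t : ℕ} {B : Set ℤ} (h : ∀ m ∈ B, m - t ∈ B) {m : ℤ} (hm : m ∈ B) (k : ℕ) :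
    m - t * k ∈ B := by
  induction k with
  | zero => simpa using hm
  | succ k ih =>
    have := h _ ih
    rwa [show m - (t : ℤ) * (k + 1 : ℕ) = m - t * k - t by push_cast; ring]

/-- If `m ∈ B` is missing from `C`, then on the runner of `m` every element of `C` lies below `m`,
hence in `B`. So `f` maps that runner of `B` into itself; being injective with finite support it is
onto, which puts `m` in `f '' B = C`. -/
theorem SameCharges.subset {t : ℕ} (ht : 0 < t) {B C : Set ℤ} (h : SameCharges t B C)
    (hB : ∀ m ∈ B, m - t ∈ B) (hC : ∀ m ∈ C, m - t ∈ C) : B ⊆ C := by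
  intro m hm
  by_contra hmC
  obtain ⟨f, h1, h2, rfl⟩ := h
  have ht' : (0 : ℤ) < t := by exact_mod_cast ht
  -- `f` maps the part of `B` on the runner of `m` into itself
  have hsub : ∀ b ∈ B, (t : ℤ) ∣ b - m → f b ∈ B := by
    intro b hb hbm
    have hd : (t : ℤ) ∣ m - f b := by
      rw [dvd_sub_comm, ← sub_add_sub_cancel _ b]
      exact dvd_add (h2 b) hbm
    obtain ⟨k, hk⟩ := hd
    rcases le_total 0 k with h0 | h0
    · have := sub_mul_mem hB hm k.toNat
      rw [Int.toNat_of_nonneg h0, ← hk] at this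
      simpa using this
    · have := sub_mul_mem hC ⟨b, hb, rfl⟩ (-k).toNat
      rw [Int.toNat_of_nonneg (by omega)] at this
      exact absurd (by rwa [show f b - (t : ℤ) * -k = m by linarith] at this) hmC
  have hfin : (B ∩ {b | (t : ℤ) ∣ b - m} ∩ {b | f b ≠ b}).Finite := h1.inter_of_right _
  have hmaps : Set.MapsTo f (B ∩ {b | (t : ℤ) ∣ b - m} ∩ {b | f b ≠ b})
      (B ∩ {b | (t : ℤ) ∣ b - m} ∩ {b | f b ≠ b}) := by
    rintro b ⟨⟨hb1, hb2⟩, hb3⟩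
    refine ⟨⟨hsub b hb1 hb2, ?_⟩, fun he => hb3 (f.injective he)⟩
    have := dvd_add (h2 b) hb2
    rwa [sub_add_sub_cancel] at this
  have hsurj := ((Set.mapsTo_iff_image_subset.1 hmaps))
  have heq := Set.eq_of_subset_of_ncard_le hsurj
    (by rw [Set.ncard_image_of_injective _ f.injective]) hfin
  apply hmC
  by_cases hfm : f m = m
  · exact ⟨m, hm, hfm⟩
  · have hmem : m ∈ B ∩ {b | (t : ℤ) ∣ b - m} ∩ {b | f b ≠ b} := ⟨⟨hm, by simp⟩, hfm⟩
    rw [← heq] at hmem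
    obtain ⟨b, hb, hbm⟩ := hmem
    exact ⟨b, hb.1.1, hbm⟩

theorem SameCharges.eq {t : ℕ} (ht : 0 < t) {B C : Set ℤ} (h : SameCharges t B C)
    (hB : ∀ m ∈ B, m - t ∈ B) (hC : ∀ m ∈ C, m - t ∈ C) : B = C :=
  (h.subset ht hB hC).antisymm (h.symm.subset ht hC hB)

theorem sameCharges_of_removesHook {t : ℕ} {lam mu : YoungDiagram} (h : RemovesHook t lam mu) :
    SameCharges t (betaSet lam) (betaSet mu) := by
  obtain ⟨m, -, -, h3⟩ := betaSet_of_removesHook h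
  refine ⟨Equiv.swap m (m - t), (Set.toFinite {m, m - (t : ℤ)}).subset fun x hx => ?_,
    fun x => ?_, h3.symm⟩
  · by_contra hn
    simp only [Set.mem_insert_iff, Set.mem_singleton_iff, not_or] at hn
    exact hx (Equiv.swap_apply_of_ne_of_ne hn.1 hn.2)
  · rw [Equiv.swap_apply_def]
    split_ifs with h1 h2
    · simp [h1]
    · simp [h2]
    · simp

theorem sameCharges_of_isCoreOf {t : ℕ} {lam nu : YoungDiagram} (h : IsCoreOf t nu lam) :
    SameCharges t (betaSet lam) (betaSet nu) := by
  obtain ⟨h, -⟩ := h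
  induction h with
  | refl => exact .refl _ _
  | tail _ h ih => exact ih.trans (sameCharges_of_removesHook h)

theorem eq_of_sameCharges {t : ℕ} (ht : 0 < t) {lam mu : YoungDiagram} (hl : IsCore t lam)
    (hm : IsCore t mu) (h : SameCharges t (betaSet lam) (betaSet mu)) : lam = mu :=
  betaSet_injective (h.eq ht ((isCore_iff lam ht).1 hl) ((isCore_iff mu ht).1 hm))

/-! ### Invariance of runner charges under the level `t` action -/

theorem exists_betaSet_bound (lam : YoungDiagram) :
    ∃ M : ℕ, (∀ m : ℤ, m < -M → m ∈ betaSet lam) ∧ ∀ m ∈ betaSet lam, m < M := by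
  refine ⟨lam.colLen 0 + lam.rowLen 0, fun m hm => (charged_betaSet lam).1 m (by push_cast at hm; omega), ?_⟩
  rintro _ ⟨r, rfl⟩
  have := lam.rowLen_anti 0 r (Nat.zero_le r)
  simp only
  push_cast
  omega

theorem gen_mul_self (s : ℕ) [Fact (1 < s)] (i : ZMod s) : gen s i * gen s i = 1 := by
  apply Subtype.ext
  ext m
  exact genFun_involutive s i m

/-- An involution moving every integer by a bounded multiple of `t` preserves runner charges. -/
theorem sameCharges_involution {t D : ℕ} (w : Equiv.Perm ℤ) (hw : ∀ m, w (w m) = m)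
    (ht : ∀ m, (t : ℤ) ∣ w m - m) (hD : ∀ m, |w m - m| ≤ D) (lam : YoungDiagram) :
    SameCharges t (betaSet lam) (w '' betaSet lam) := by
  classical
  -- `w` may have infinite support. Undoing it wherever `m` and `w m` are both beads or both gaps
  -- does not change the image of the beta-set, and leaves only finitely many moved points.
  let f : ℤ → ℤ := fun m => if (m ∈ betaSet lam ↔ w m ∈ betaSet lam) then m else w m
  have hf : Function.Involutive f := by
    intro m
    by_cases h : (m ∈ betaSet lam ↔ w m ∈ betaSet lam)
    · simp only [f, if_pos h]
    · have h' : ¬ (w m ∈ betaSet lam ↔ w (w m) ∈ betaSet lam) := by rw [hw]; tauto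
      simp only [f, if_neg h, if_neg h', hw]
  obtain ⟨M, hM1, hM2⟩ := exists_betaSet_bound lam
  refine ⟨hf.toPerm, (Set.finite_Icc (-(M + D : ℤ)) (M + D)).subset fun m hm => ?_, fun m => ?_, ?_⟩
  · by_contra hn
    apply hm
    have hb := abs_le.1 (hD m)
    rw [Set.mem_Icc, not_and_or] at hn
    refine if_pos ?_
    rcases hn with hn | hn
    · exact iff_of_true (hM1 _ (by omega)) (hM1 _ (by omega))
    · exact iff_of_false (fun h => by have := hM2 _ h; omega)
        (fun h => by have := hM2 _ h; omega)
  · change (t : ℤ) ∣ f m - m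
    simp only [f]
    split_ifs
    · simp
    · exact ht m
  · have hws : w.symm = w := Equiv.ext fun m => by rw [Equiv.symm_apply_eq, hw]
    rw [Equiv.image_eq_preimage_symm, Equiv.image_eq_preimage_symm, hws,
      Function.Involutive.toPerm_symm]
    ext m
    change f m ∈ betaSet lam ↔ w m ∈ betaSet lam
    simp only [f]
    split_ifs with h
    · exact h
    · rfl

theorem sameCharges_levelPart_gen {s t : ℕ} [Fact (1 < s)] (hst : s.Coprime t) (i : ZMod s)
    (lam : YoungDiagram) :
    SameCharges t (betaSet lam) (betaSet (levelPart s t hst (gen s i) lam)) := by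
  rw [betaSet_levelPart]
  refine sameCharges_involution (D := t) _ (fun m => ?_) (fun m => ?_) (fun m => ?_) lam
  · rw [← Equiv.Perm.mul_apply, ← map_mul, gen_mul_self, map_one, Equiv.Perm.one_apply]
  · rw [levelInt_gen]
    split_ifs <;> simp
  · rw [levelInt_gen]
    split_ifs <;> simp

theorem levelPart_mul {s t : ℕ} [NeZero s] (hst : s.Coprime t) (v w : affineSymm s)
    (lam : YoungDiagram) :
    levelPart s t hst (v * w) lam = levelPart s t hst v (levelPart s t hst w lam) := by
  rw [map_mul, Equiv.Perm.mul_apply]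

theorem sameCharges_levelPart {s t : ℕ} [Fact (1 < s)] (hst : s.Coprime t) {v : affineSymm s}
    (hv : v ∈ hyp s) (lam : YoungDiagram) :
    SameCharges t (betaSet lam) (betaSet (levelPart s t hst v lam)) := by
  have hg := fun i => sameCharges_levelPart_gen hst (s := s) i
  induction hv using Subgroup.closure_induction generalizing lam with
  | mem x hx =>
    obtain ⟨i, rfl⟩ := hx
    unfold hypGen
    split_ifs
    · exact hg _ _
    · rw [levelPart_mul, levelPart_mul]
      exact ((hg _ _).trans (hg _ _)).trans (hg _ _)
    · rw [levelPart_mul]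
      exact (hg _ _).trans (hg _ _)
  | one => rw [map_one]; exact .refl _ _
  | mul x y _ _ hx hy => rw [levelPart_mul]; exact (hy _).trans (hx _)
  | inv x _ hx =>
    have := hx (levelPart s t hst x⁻¹ lam)
    rw [← levelPart_mul, mul_inv_cancel, map_one] at this
    exact this.symm

/-! ### Runner ends of a core -/

/-- `q i` is the least integer outside `B` that is congruent to `i t - c` modulo `s`, where `B` is
closed under subtracting `s`. -/
def IsEnds (s t : ℕ) (q : ZMod s → ℤ) (B : Set ℤ) : Prop :=
  (∀ i, (q i : ZMod s) = i * t - shift s t) ∧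
    ∀ m : ℤ, m ∈ B ↔ m < q ((t : ZMod s)⁻¹ * ((m : ZMod s) + shift s t))

theorem index_eq_iff {s t : ℕ} (hst : s.Coprime t) (x i : ZMod s) :
    (t : ZMod s)⁻¹ * (x + shift s t) = i ↔ x = i * t - shift s t := by
  have h := inv_mul_self hst
  constructor
  · rintro rfl
    linear_combination (-x - (shift s t : ZMod s)) * h
  · rintro rfl
    linear_combination i * h

theorem pos_of_coprime {s t : ℕ} [Fact (1 < s)] (hst : s.Coprime t) : 0 < t := by
  rcases Nat.eq_zero_or_pos t with rfl | h
  · have hs : 1 < s := Fact.out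
    rw [Nat.coprime_zero_right] at hst
    omega
  · exact h

/-- Coprimality makes `(s - 1) * (t - 1)` even, so the halving in `shift` is exact. The congruence
is what makes `m ↦ -1 - m` send the class with index `i` to the class with index `-1 - i`. -/
theorem two_mul_shift {s t : ℕ} [Fact (1 < s)] (hst : s.Coprime t) :
    (2 * shift s t + t : ZMod s) = 1 := by
  have hs : 1 < s := Fact.out
  have ht : 0 < t := pos_of_coprime hst
  have hev : 2 ∣ (s - 1) * (t - 1) := by
    rcases Nat.even_or_odd s with h | h
    · have hodd : Odd t := by
        rw [← Nat.not_even_iff_odd]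
        intro h'
        have := Nat.dvd_gcd h.two_dvd h'.two_dvd
        rw [hst] at this
        omega
      exact Dvd.dvd.mul_left (by obtain ⟨k, hk⟩ := hodd; omega) _
    · exact Dvd.dvd.mul_right (by obtain ⟨k, hk⟩ := h; omega) _
  have h2 : 2 * shift s t = (s - 1) * (t - 1) := Nat.mul_div_cancel' hev
  have h3 : ((2 * shift s t : ℕ) : ZMod s) = ((s - 1) * (t - 1) : ℕ) := by rw [h2]
  rw [Nat.cast_mul, Nat.cast_mul, Nat.cast_pred (by omega), Nat.cast_pred ht,
    ZMod.natCast_self] at h3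
  push_cast at h3
  linear_combination h3

theorem IsEnds.mem_iff {s t : ℕ} (hst : s.Coprime t) {q : ZMod s → ℤ} {B : Set ℤ}
    (h : IsEnds s t q B) {m : ℤ} {i : ZMod s} (hm : (m : ZMod s) = i * t - shift s t) :
    m ∈ B ↔ m < q i := by
  rw [h.2, (index_eq_iff hst _ _).2 hm]

/-- The beta-set of an `s`-core fills each residue class modulo `s` from below, so the class is
described by its least gap. That gap exists because the beta-set is bounded above and contains all
sufficiently negative integers. -/
theorem exists_isEnds {s t : ℕ} [Fact (1 < s)] (hst : s.Coprime t) {lam : YoungDiagram}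
    (h : IsCore s lam) : ∃ q, IsEnds s t q (betaSet lam) := by
  have hs : 1 < s := Fact.out
  rw [isCore_iff lam (by omega)] at h
  obtain ⟨M, hM1, hM2⟩ := exists_betaSet_bound lam
  have hex : ∀ i : ZMod s, ∃ k : ℤ, ((i * t - shift s t).val + s * k : ℤ) ∉ betaSet lam ∧
      ∀ l : ℤ, ((i * t - shift s t).val + s * l : ℤ) ∉ betaSet lam → k ≤ l := by
    intro i
    apply Int.exists_least_of_bdd
    · refine ⟨-(M + s), fun z hz => ?_⟩
      by_contra hlt
      refine hz (hM1 _ ?_)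
      have := ZMod.val_lt (i * t - shift s t : ZMod s)
      zify at this hs
      nlinarith
    · refine ⟨M, fun hn => ?_⟩
      have := hM2 _ hn
      zify at hs
      nlinarith [Int.natCast_nonneg (i * t - shift s t : ZMod s).val, Int.natCast_nonneg M]
  choose k hk1 hk2 using hex
  refine ⟨fun i => (i * t - shift s t).val + s * k i, fun i => by simp, fun m => ?_⟩
  obtain ⟨i, hi⟩ : ∃ i : ZMod s, (t : ZMod s)⁻¹ * ((m : ZMod s) + shift s t) = i := ⟨_, rfl⟩
  rw [hi]
  rw [index_eq_iff hst] at hi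
  obtain ⟨l, hl⟩ : ∃ l : ℤ, m = ((i * t - shift s t : ZMod s).val : ℤ) + s * l := by
    apply exists_mul_of_cast_eq
    simpa using hi
  constructor
  · intro hm
    by_contra hlt
    have hkl : k i ≤ l := by
      zify at hs
      by_contra hkl
      nlinarith
    refine hk1 i ?_
    have := sub_mul_mem h hm (l - k i).toNat
    rw [Int.toNat_of_nonneg (by omega), hl] at this
    convert this using 1
    ring
  · intro hm
    by_contra hn
    rw [hl] at hn hm
    have := hk2 i l hn
    zify at hs
    nlinarith

/-- The effect of the level `t` action of `w_i` on runner ends. -/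
def swapEnds {s : ℕ} (t : ℕ) (i : ZMod s) (q : ZMod s → ℤ) : ZMod s → ℤ :=
  fun j => if j = i - 1 then q i - t else if j = i then q (i - 1) + t else q j

/-- The generator translates the class `(i - 1) t - c` by `t` onto the class `i t - c`, and the
latter back by `-t`; the first gaps travel with their classes. -/
theorem IsEnds.levelPart_gen {s t : ℕ} [Fact (1 < s)] (hst : s.Coprime t) {q : ZMod s → ℤ}
    {lam : YoungDiagram} (h : IsEnds s t q (betaSet lam)) (i : ZMod s) :
    IsEnds s t (swapEnds t i q) (betaSet (levelPart s t hst (gen s i) lam)) := by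
  have hne : i ≠ i - 1 := fun h => one_ne_zero (sub_eq_self.1 h.symm)
  constructor
  · intro j
    unfold swapEnds
    split_ifs with h1 h2
    · rw [h1]
      push_cast
      rw [h.1]
      ring
    · rw [h2]
      push_cast
      rw [h.1]
      ring
    · exact h.1 j
  · intro m
    have hw : ∀ m, levelInt s t hst (gen s i) (levelInt s t hst (gen s i) m) = m := fun m => by
      rw [← Equiv.Perm.mul_apply, ← map_mul, gen_mul_self, map_one, Equiv.Perm.one_apply]
    have hmem : m ∈ betaSet (levelPart s t hst (gen s i) lam) ↔
        levelInt s t hst (gen s i) m ∈ betaSet lam := by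
      rw [betaSet_levelPart, Equiv.image_eq_preimage_symm, Set.mem_preimage,
        show (levelInt s t hst (gen s i)).symm m = levelInt s t hst (gen s i) m by
          rw [Equiv.symm_apply_eq, hw]]
    rw [hmem, levelInt_gen]
    unfold swapEnds
    simp only [index_eq_iff hst]
    split_ifs with h1 h2
    · rw [h.mem_iff hst (i := i) (by push_cast; rw [h1]; ring)]
      omega
    · rw [h.mem_iff hst (i := i - 1) (by push_cast; rw [h2]; ring)]
      omega
    · exact h.2 m

/-! ### Conjugation and energy of runner ends -/

/-- The symmetry of the runner ends of a self-conjugate core. -/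
def IsSymm {s : ℕ} (q : ZMod s → ℤ) : Prop := ∀ i, q (-1 - i) = s - 1 - q i

/-- The map `m ↦ -1 - m` must exchange beads and gaps, so it sends the last bead `q i - s` of one
class to the first gap of the reflected class. -/
theorem IsEnds.isSymm_iff {s t : ℕ} [Fact (1 < s)] (hst : s.Coprime t) {q : ZMod s → ℤ}
    {lam : YoungDiagram} (h : IsEnds s t q (betaSet lam)) :
    lam.transpose = lam ↔ IsSymm q := by
  have hs : 1 < s := Fact.out
  have hc := two_mul_shift (s := s) hst
  have hneg : ∀ (x i : ZMod s), x = i * t - shift s t → -1 - x = (-1 - i) * t - shift s t := by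
    rintro x i rfl
    linear_combination hc
  rw [transpose_eq_self_iff]
  constructor
  · intro hsym i
    have h1 : q i ∉ betaSet lam := by rw [h.mem_iff hst (h.1 i)]; omega
    have h2 : q i - s ∈ betaSet lam := by
      rw [h.mem_iff hst (i := i) (by simpa using h.1 i)]
      omega
    have h3 : -1 - q i ∈ betaSet lam := by
      rw [hsym]
      rwa [show -1 - (-1 - q i) = q i by ring]
    have h4 := (hsym _).1 h2
    rw [h.mem_iff hst (i := -1 - i) (by push_cast; exact hneg _ _ (h.1 i))] at h3
    rw [h.mem_iff hst (i := -1 - i)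
      (by push_cast; rw [ZMod.natCast_self, sub_zero]; exact hneg _ _ (h.1 i))] at h4
    obtain ⟨k, hk⟩ : ∃ k : ℤ, q (-1 - i) = -1 - q i + s * k := by
      apply exists_mul_of_cast_eq
      rw [h.1]
      push_cast
      exact (hneg _ _ (h.1 i)).symm
    -- `-1 - q i` is a bead and `-1 - q i + s` is a gap, so the first gap of their class is the
    -- latter.
    have hk1 : k = 1 := by
      zify at hs
      apply le_antisymm
      · by_contra hlt
        nlinarith
      · by_contra hlt
        nlinarith
    rw [hk1] at hk
    linarith
  · intro hq m
    obtain ⟨i, hi⟩ : ∃ i : ZMod s, (t : ZMod s)⁻¹ * ((m : ZMod s) + shift s t) = i := ⟨_, rfl⟩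
    rw [index_eq_iff hst] at hi
    rw [h.mem_iff hst hi, h.mem_iff hst (i := -1 - i) (by push_cast; exact hneg _ _ hi), hq]
    obtain ⟨k, hk⟩ : ∃ k : ℤ, m = q i + s * k := by
      apply exists_mul_of_cast_eq
      rw [hi, h.1]
    rw [hk]
    zify at hs
    constructor
    · intro hlt hlt'
      have h1 : k < 0 := by by_contra h0; nlinarith
      have h2 : -1 < k := by by_contra h0; nlinarith
      omega
    · intro hlt
      by_contra h0
      have : 0 ≤ k := by by_contra h1; nlinarith
      apply hlt
      nlinarith

theorem isCore_of_isEnds {s t : ℕ} [Fact (1 < s)] {q : ZMod s → ℤ}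
    {lam : YoungDiagram} (h : IsEnds s t q (betaSet lam)) : IsCore s lam := by
  have hs : 1 < s := Fact.out
  rw [isCore_iff lam (by omega)]
  intro m hm
  rw [h.2] at hm ⊢
  push_cast
  rw [ZMod.natCast_self, sub_zero]
  omega

theorem mem_scCores_iff {s t : ℕ} [Fact (1 < s)] (hst : s.Coprime t) (lam : YoungDiagram) :
    lam ∈ scCores s ↔ ∃ q, IsEnds s t q (betaSet lam) ∧ IsSymm q := by
  constructor
  · rintro ⟨h1, h2⟩
    obtain ⟨q, hq⟩ := exists_isEnds hst h2
    exact ⟨q, hq, (hq.isSymm_iff hst).1 h1⟩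
  · rintro ⟨q, hq, hs⟩
    exact ⟨(hq.isSymm_iff hst).2 hs, isCore_of_isEnds hq⟩

/-- The conjugate of a system of runner ends. -/
def conjEnds {s : ℕ} (q : ZMod s → ℤ) : ZMod s → ℤ := fun i => s - 1 - q (-1 - i)

theorem isSymm_iff_conjEnds {s : ℕ} (q : ZMod s → ℤ) : IsSymm q ↔ conjEnds q = q := by
  constructor
  · intro h
    funext i
    rw [conjEnds, h]
    ring
  · intro h i
    have := congrFun h i
    rw [conjEnds] at this
    linarith

/-- The reflection `j ↦ -1 - j` exchanges the pairs `{i - 1, i}` and `{-i - 1, -i}`; thus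
conjugation intertwines `w_i` and `w_{-i}`. -/
theorem conjEnds_swapEnds {s : ℕ} [Fact (1 < s)] (t : ℕ) (i : ZMod s) (q : ZMod s → ℤ) :
    conjEnds (swapEnds t i q) = swapEnds t (-i) (conjEnds q) := by
  have h1 : i ≠ i - 1 := fun h => one_ne_zero (sub_eq_self.1 h.symm)
  funext j
  have e1 : -1 - j = i - 1 ↔ j = -i :=
    ⟨fun h => by linear_combination -h, fun h => by linear_combination -h⟩
  have e2 : -1 - j = i ↔ j = -i - 1 :=
    ⟨fun h => by linear_combination -h, fun h => by linear_combination -h⟩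
  have e3 : -i ≠ -i - 1 := fun h => one_ne_zero (sub_eq_self.1 h.symm)
  simp only [conjEnds, swapEnds, e1, e2]
  by_cases hj : j = -i
  · rw [if_pos hj, if_neg (hj ▸ e3), if_pos hj, show -1 - (-i - 1) = i by ring]
    ring
  · rw [if_neg hj]
    by_cases hj' : j = -i - 1
    · rw [if_pos hj', if_pos hj', show -1 - -i = i - 1 by ring]
      ring
    · rw [if_neg hj', if_neg hj', if_neg hj]

theorem swapEnds_comm {s : ℕ} (t : ℕ) {i j : ZMod s} (h1 : i ≠ j) (h2 : i ≠ j - 1)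
    (h3 : i - 1 ≠ j) (q : ZMod s → ℤ) :
    swapEnds t i (swapEnds t j q) = swapEnds t j (swapEnds t i q) := by
  have h4 : i - 1 ≠ j - 1 := fun h => h1 (sub_left_injective h)
  funext k
  simp only [swapEnds]
  grind

/-- The condition `2 ≠ 0` rules out `s = 2`: the indices `i`, `i - 1`, `i - 2` have to be distinct.
-/
theorem swapEnds_braid {s : ℕ} [Fact (1 < s)] (t : ℕ) (i : ZMod s) (h2 : (2 : ZMod s) ≠ 0)
    (q : ZMod s → ℤ) :
    swapEnds t i (swapEnds t (i - 1) (swapEnds t i q))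
      = swapEnds t (i - 1) (swapEnds t i (swapEnds t (i - 1) q)) := by
  have h1 : i ≠ i - 1 := fun h => one_ne_zero (sub_eq_self.1 h.symm)
  have h3 : i ≠ i - 1 - 1 := fun h => h2 (by linear_combination h)
  have h4 : i - 1 ≠ i - 1 - 1 := fun h => one_ne_zero (sub_eq_self.1 h.symm)
  funext k
  simp only [swapEnds]
  grind

/-- The sum of the squares of the runner ends. -/
def energy {s : ℕ} [NeZero s] (q : ZMod s → ℤ) : ℤ := ∑ i, q i ^ 2

theorem energy_swapEnds {s : ℕ} [Fact (1 < s)] (t : ℕ) (i : ZMod s) (q : ZMod s → ℤ) :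
    energy (swapEnds t i q) = energy q - 2 * t * (q i - q (i - 1) - t) := by
  have h1 : i ≠ i - 1 := fun h => one_ne_zero (sub_eq_self.1 h.symm)
  have h : ∀ j, swapEnds t i q j ^ 2 = q j ^ 2 + (if j = i - 1 then (q i - t) ^ 2 - q (i - 1) ^ 2 else 0)
      + (if j = i then (q (i - 1) + t) ^ 2 - q i ^ 2 else 0) := by
    intro j
    unfold swapEnds
    by_cases hj : j = i - 1
    · subst hj
      rw [if_pos rfl, if_pos rfl, if_neg h1.symm]
      ring
    · rw [if_neg hj, if_neg hj]
      by_cases hj' : j = i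
      · subst hj'
        rw [if_pos rfl, if_pos rfl]
        ring
      · rw [if_neg hj', if_neg hj']
        ring
  simp only [energy, h, Finset.sum_add_distrib, Finset.sum_ite_eq', Finset.mem_univ, if_true]
  ring

/-! ### The action of the affine hyperoctahedral group on cores -/

theorem eq_zero_or_of_two_mul {s : ℕ} [Fact (1 < s)] {i : ZMod s} (h : 2 * i = 0) :
    i = 0 ∨ i = ((s / 2 : ℕ) : ZMod s) := by
  have hlt := ZMod.val_lt i
  have h' : ((2 * i.val : ℕ) : ZMod s) = 0 := by push_cast; simpa using h
  rw [ZMod.natCast_eq_zero_iff] at h'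
  obtain ⟨k, hk⟩ := h'
  have hk2 : k < 2 := by by_contra hge; nlinarith
  interval_cases k
  · exact Or.inl ((ZMod.val_eq_zero i).1 (by omega))
  · right
    rw [show s / 2 = i.val by omega]
    simp

theorem eq_half_of_two_mul {s : ℕ} [Fact (1 < s)] {i : ZMod s} (h : 2 * i = -1) :
    i = ((s / 2 : ℕ) : ZMod s) := by
  have hlt := ZMod.val_lt i
  have h' : ((2 * i.val + 1 : ℕ) : ZMod s) = 0 := by
    push_cast
    simp only [ZMod.natCast_val, ZMod.cast_id', id_eq, h]
    ring
  rw [ZMod.natCast_eq_zero_iff] at h'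
  obtain ⟨k, hk⟩ := h'
  have hk2 : k < 2 := by by_contra hge; nlinarith
  interval_cases k
  · omega
  · rw [show s / 2 = i.val by omega]
    simp

theorem two_mul_half {s : ℕ} :
    2 * ((s / 2 : ℕ) : ZMod s) = 0 ∨ 2 * ((s / 2 : ℕ) : ZMod s) = -1 := by
  have h : ((2 * (s / 2) + s % 2 : ℕ) : ZMod s) = 0 := by rw [Nat.div_add_mod, ZMod.natCast_self]
  push_cast [Nat.cast_add, Nat.cast_mul] at h
  rcases Nat.mod_two_eq_zero_or_one s with h2 | h2
  · left
    rw [h2] at h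
    simpa using h
  · right
    rw [h2] at h
    push_cast at h
    linear_combination h

/-- The three shapes of the generator `v_i`. -/
theorem hypGen_cases {s : ℕ} [Fact (1 < s)] (i : ZMod s) :
    (-i = i ∧ hypGen s i = gen s i) ∨
    ((-i = i - 1 ∨ i = -i - 1) ∧ (2 : ZMod s) ≠ 0 ∧
      hypGen s i = gen s i * gen s (-i) * gen s i) ∨
    (i ≠ -i ∧ i ≠ -i - 1 ∧ i - 1 ≠ -i ∧ hypGen s i = gen s i * gen s (-i)) := by
  by_cases h0 : i = 0
  · exact Or.inl ⟨by simp [h0], by rw [hypGen, if_pos h0]⟩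
  by_cases hu : i = ((s / 2 : ℕ) : ZMod s) ∨ i = -((s / 2 : ℕ) : ZMod s)
  · have hg : hypGen s i = gen s i * gen s (-i) * gen s i := by rw [hypGen, if_neg h0, if_pos hu]
    have h2 : 2 * i = 0 ∨ 2 * i = -1 ∨ 2 * i = 1 := by
      rcases two_mul_half (s := s) with h | h <;> rcases hu with rfl | rfl
      · exact Or.inl h
      · exact Or.inl (by linear_combination -h)
      · exact Or.inr (Or.inl h)
      · exact Or.inr (Or.inr (by linear_combination -h))
    -- If `2 * i = 0`, then `w_i` and `w_{-i}` coincide and the triple product collapses to `w_i`.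
    -- Otherwise `2 * i = ±1`, so `i` and `-i` are adjacent.
    rcases h2 with h2 | h2
    · have hi : -i = i := by linear_combination -h2
      exact Or.inl ⟨hi, by rw [hg, hi, gen_mul_self, one_mul]⟩
    · refine Or.inr (Or.inl ⟨?_, fun h => ?_, hg⟩)
      · rcases h2 with h2 | h2
        · exact Or.inr (by linear_combination h2)
        · exact Or.inl (by linear_combination -h2)
      · rcases h2 with h2 | h2
        · exact one_ne_zero (α := ZMod s) (by linear_combination h2 - i * h)
        · exact one_ne_zero (α := ZMod s) (by linear_combination -h2 + i * h)
  · have hg : hypGen s i = gen s i * gen s (-i) := by rw [hypGen, if_neg h0, if_neg hu]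
    rw [not_or] at hu
    refine Or.inr (Or.inr ⟨fun h => ?_, fun h => ?_, fun h => ?_, hg⟩)
    · exact (eq_zero_or_of_two_mul (i := i) (by linear_combination h)).elim h0 hu.1
    · exact hu.1 (eq_half_of_two_mul (by linear_combination h))
    · apply hu.2
      rw [← eq_half_of_two_mul (i := -i) (by linear_combination -h), neg_neg]

/-- A generator of the affine hyperoctahedral group maps symmetric runner ends to symmetric runner
ends, and lowers their energy if the corresponding gap exceeds `t`. -/
theorem exists_isEnds_hypGen {s t : ℕ} [Fact (1 < s)] (hst : s.Coprime t) (ht : 0 < t)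
    {q : ZMod s → ℤ} {lam : YoungDiagram} (h : IsEnds s t q (betaSet lam)) (hq : IsSymm q)
    (i : ZMod s) :
    ∃ q', IsEnds s t q' (betaSet (levelPart s t hst (hypGen s i) lam)) ∧ IsSymm q' ∧
      (t < q i - q (i - 1) → energy q' < energy q) := by
  have h1 : ∀ i : ZMod s, i ≠ i - 1 := fun i h => one_ne_zero (sub_eq_self.1 h.symm)
  have hc := (isSymm_iff_conjEnds q).1 hq
  have hgap : q (-i) - q (-i - 1) = q i - q (i - 1) := by
    rw [show -i = -1 - (i - 1) by ring, hq, show -1 - (i - 1) - 1 = -1 - i by ring, hq]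
    ring
  have ht' : (0 : ℤ) < t := by exact_mod_cast ht
  rcases hypGen_cases i with ⟨hi, hg⟩ | ⟨hi, h2, hg⟩ | ⟨hi1, hi2, hi3, hg⟩
  · refine ⟨_, hg ▸ h.levelPart_gen hst i, ?_, fun hlt => ?_⟩
    · rw [isSymm_iff_conjEnds, conjEnds_swapEnds, hi, hc]
    · rw [energy_swapEnds]
      nlinarith
  · refine ⟨swapEnds t i (swapEnds t (-i) (swapEnds t i q)), ?_, ?_, fun hlt => ?_⟩
    · rw [hg, levelPart_mul, levelPart_mul]
      exact ((h.levelPart_gen hst i).levelPart_gen hst (-i)).levelPart_gen hst i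
    · rw [isSymm_iff_conjEnds, conjEnds_swapEnds, conjEnds_swapEnds, conjEnds_swapEnds, hc,
        neg_neg]
      -- Conjugation turns the word `w_i w_{-i} w_i` into `w_{-i} w_i w_{-i}`; the two agree by the
      -- braid relation, as `i` and `-i` are adjacent.
      rcases hi with hi | hi
      · rw [hi]
        exact (swapEnds_braid t i h2 q).symm
      · have := swapEnds_braid t (-i) h2 q
        rwa [← hi] at this
    · have h3 : i ≠ i - 1 - 1 := fun h => h2 (by linear_combination h)
      have h4 : i - 1 ≠ i - 1 - 1 := h1 (i - 1)
      have h5 : -i ≠ -i - 1 - 1 := fun h => h2 (by linear_combination h)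
      have h6 : -i - 1 ≠ -i - 1 - 1 := h1 (-i - 1)
      have h7 := h1 i
      have h8 := h1 (-i)
      -- With `g = q i - q (i - 1)`, which by symmetry is also the gap at `-i`, the three successive
      -- gaps are `g`, `2 * g - t` and `g`. All exceed `t` when `g` does, so every step lowers the
      -- energy.
      have e1 : swapEnds t i q (-i) - swapEnds t i q (-i - 1) = 2 * (q i - q (i - 1)) - t := by
        simp only [swapEnds]
        rcases hi with hi | hi <;> grind
      have e2 : swapEnds t (-i) (swapEnds t i q) i - swapEnds t (-i) (swapEnds t i q) (i - 1)
          = q i - q (i - 1) := by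
        simp only [swapEnds]
        rcases hi with hi | hi <;> grind
      rw [energy_swapEnds, energy_swapEnds, energy_swapEnds, e1, e2]
      nlinarith
  · refine ⟨swapEnds t i (swapEnds t (-i) q), ?_, ?_, fun hlt => ?_⟩
    · rw [hg, levelPart_mul]
      exact (h.levelPart_gen hst (-i)).levelPart_gen hst i
    · rw [isSymm_iff_conjEnds, conjEnds_swapEnds, conjEnds_swapEnds, hc, neg_neg,
        swapEnds_comm t hi1 hi2 hi3]
    · have e : swapEnds t (-i) q i - swapEnds t (-i) q (i - 1) = q i - q (i - 1) := by
        have hi4 : i - 1 ≠ -i - 1 := fun h => hi1 (sub_left_injective h)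
        simp only [swapEnds, if_neg hi1, if_neg hi2, if_neg hi3, if_neg hi4]
      rw [energy_swapEnds, energy_swapEnds, e, hgap]
      nlinarith

/-- Mapping a set into itself does not pass to inverses, so the closure induction for `scCores` must
treat inverses of generators directly. -/
theorem hypGen_inv {s : ℕ} [Fact (1 < s)] (i : ZMod s) : ∃ j, (hypGen s i)⁻¹ = hypGen s j := by
  have hinv : ∀ i, (gen s i)⁻¹ = gen s i := fun i => inv_eq_of_mul_eq_one_left (gen_mul_self s i)
  by_cases h0 : i = 0
  · exact ⟨i, by rw [hypGen, if_pos h0, hinv]⟩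
  by_cases hu : i = ((s / 2 : ℕ) : ZMod s) ∨ i = -((s / 2 : ℕ) : ZMod s)
  · refine ⟨i, ?_⟩
    rw [hypGen, if_neg h0, if_pos hu, mul_inv_rev, mul_inv_rev, hinv, hinv, mul_assoc]
  · refine ⟨-i, ?_⟩
    have hu' : ¬ (-i = ((s / 2 : ℕ) : ZMod s) ∨ -i = -((s / 2 : ℕ) : ZMod s)) := by
      rw [neg_inj, neg_eq_iff_eq_neg]
      tauto
    rw [hypGen, hypGen, if_neg h0, if_neg hu, if_neg (neg_ne_zero.2 h0), if_neg hu', mul_inv_rev,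
      hinv, hinv, neg_neg]

theorem levelPart_mem_scCores {s t : ℕ} [Fact (1 < s)] (hst : s.Coprime t) (ht : 0 < t)
    {v : affineSymm s} (hv : v ∈ hyp s) {lam : YoungDiagram} (hl : lam ∈ scCores s) :
    levelPart s t hst v lam ∈ scCores s := by
  have hgen : ∀ i, ∀ lam ∈ scCores s, levelPart s t hst (hypGen s i) lam ∈ scCores s := by
    intro i lam hl
    obtain ⟨q, hq, hs⟩ := (mem_scCores_iff hst lam).1 hl
    obtain ⟨q', hq', hs', -⟩ := exists_isEnds_hypGen hst ht hq hs i
    exact (mem_scCores_iff hst _).2 ⟨q', hq', hs'⟩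
  induction hv using Subgroup.closure_induction'' generalizing lam with
  | mem x hx =>
    obtain ⟨i, rfl⟩ := hx
    exact hgen i lam hl
  | inv_mem x hx =>
    obtain ⟨i, rfl⟩ := hx
    obtain ⟨j, hj⟩ := hypGen_inv i
    rw [hj]
    exact hgen j lam hl
  | one => rwa [map_one]
  | mul x y _ _ hx hy => rw [levelPart_mul]; exact hx (hy hl)

/-! ### Orbits and `t`-cores -/

theorem hypOrbit_trans {s t : ℕ} [Fact (1 < s)] {hst : s.Coprime t} {lam mu nu : YoungDiagram}
    (h : mu ∈ hypOrbit s t hst lam) (h' : nu ∈ hypOrbit s t hst mu) :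
    nu ∈ hypOrbit s t hst lam := by
  obtain ⟨v, hv, rfl⟩ := h
  obtain ⟨w, hw, rfl⟩ := h'
  exact ⟨w * v, mul_mem hw hv, levelPart_mul hst w v lam⟩

theorem hypOrbit_symm {s t : ℕ} [Fact (1 < s)] {hst : s.Coprime t} {lam mu : YoungDiagram}
    (h : mu ∈ hypOrbit s t hst lam) : lam ∈ hypOrbit s t hst mu := by
  obtain ⟨v, hv, rfl⟩ := h
  refine ⟨v⁻¹, inv_mem hv, ?_⟩
  rw [← levelPart_mul, inv_mul_cancel, map_one, Equiv.Perm.one_apply]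

/-- A bead `m` in class `i` with a gap at `m - t`, which lies in class `i - 1`, gives `q (i - 1) ≤ m
- t` and `m < q i`. -/
theorem IsEnds.exists_gap {s t : ℕ} (hst : s.Coprime t) (ht : 0 < t)
    {q : ZMod s → ℤ} {lam : YoungDiagram} (h : IsEnds s t q (betaSet lam))
    (hcore : ¬ IsCore t lam) : ∃ i, t < q i - q (i - 1) := by
  rw [isCore_iff lam ht] at hcore
  push Not at hcore
  obtain ⟨m, hm1, hm2⟩ := hcore
  obtain ⟨i, hi⟩ : ∃ i : ZMod s, (t : ZMod s)⁻¹ * ((m : ZMod s) + shift s t) = i := ⟨_, rfl⟩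
  rw [index_eq_iff hst] at hi
  rw [h.mem_iff hst hi] at hm1
  rw [h.mem_iff hst (i := i - 1) (by push_cast; rw [hi]; ring)] at hm2
  exact ⟨i, by omega⟩

/-- Descent on the energy, a nonnegative integer: while the partition is not a `t`-core, some `v_i`
lowers it and keeps the ends symmetric. -/
theorem exists_isCore_mem_hypOrbit {s t : ℕ} [Fact (1 < s)] (hst : s.Coprime t) (ht : 0 < t)
    {lam : YoungDiagram} (hl : lam ∈ scCores s) :
    ∃ nu ∈ hypOrbit s t hst lam, IsCore t nu := by
  obtain ⟨q, hq, hs⟩ := (mem_scCores_iff hst lam).1 hl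
  clear hl
  induction hn : (energy q).toNat using Nat.strong_induction_on generalizing lam q with
  | _ n ih =>
    by_cases hcore : IsCore t lam
    · exact ⟨lam, ⟨1, one_mem _, by rw [map_one, Equiv.Perm.one_apply]⟩, hcore⟩
    · obtain ⟨i, hi⟩ := hq.exists_gap hst ht hcore
      obtain ⟨q', hq', hs', hlt⟩ := exists_isEnds_hypGen hst ht hq hs i
      have hnn : 0 ≤ energy q' := Finset.sum_nonneg fun i _ => sq_nonneg _
      have := hlt hi
      obtain ⟨nu, hnu, hcore'⟩ := ih _ (by omega) q' hq' hs' rfl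
      exact ⟨nu, hypOrbit_trans ⟨_, Subgroup.subset_closure ⟨i, rfl⟩, rfl⟩ hnu, hcore'⟩

theorem IsCoreOf.unique {t : ℕ} (ht : 0 < t) {lam nu nu' : YoungDiagram} (h : IsCoreOf t nu lam)
    (h' : IsCoreOf t nu' lam) : nu = nu' :=
  eq_of_sameCharges ht h.2 h'.2
    ((sameCharges_of_isCoreOf h).symm.trans (sameCharges_of_isCoreOf h'))

/-- The descent inside the orbit need not follow hook removals. Its endpoint is nevertheless the
`t`-core, because both have the charges of `lam`. -/
theorem IsCoreOf.mem_hypOrbit {s t : ℕ} [Fact (1 < s)] (hst : s.Coprime t) (ht : 0 < t)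
    {lam nu : YoungDiagram} (hl : lam ∈ scCores s) (h : IsCoreOf t nu lam) :
    nu ∈ hypOrbit s t hst lam := by
  obtain ⟨_, ⟨v, hv, rfl⟩, hcore⟩ := exists_isCore_mem_hypOrbit hst ht hl
  rw [eq_of_sameCharges ht h.2 hcore
    ((sameCharges_of_isCoreOf h).symm.trans (sameCharges_levelPart hst hv lam))]
  exact ⟨v, hv, rfl⟩

end SCCore

theorem mainTheorem7 (s t : ℕ) [Fact (1 < s)] (hst : s.Coprime t) :
    (∀ v ∈ SCCore.hyp s, ∀ lam ∈ SCCore.scCores s,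
      SCCore.levelPart s t hst v lam ∈ SCCore.scCores s) ∧
    (∀ lam ∈ SCCore.scCores s, ∃! nu, SCCore.IsCoreOf t nu lam) ∧
    (∀ lam ∈ SCCore.scCores s, ∀ mu ∈ SCCore.scCores s,
      (∃ nu, SCCore.IsCoreOf t nu lam ∧ SCCore.IsCoreOf t nu mu) ↔
        mu ∈ SCCore.hypOrbit s t hst lam) ∧
    (∀ lam ∈ SCCore.scCores s, ∀ nu, SCCore.IsCoreOf t nu lam →
      nu ∈ SCCore.scCores s ∧ nu ∈ SCCore.hypOrbit s t hst lam) := by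
  have ht : 0 < t := SCCore.pos_of_coprime hst
  refine ⟨fun v hv lam hl => SCCore.levelPart_mem_scCores hst ht hv hl, fun lam hl => ?_,
    fun lam hl mu hm => ⟨?_, ?_⟩, fun lam hl nu h => ?_⟩
  · obtain ⟨nu, hnu⟩ := SCCore.exists_isCoreOf ht lam
    exact ⟨nu, hnu, fun nu' h => h.unique ht hnu⟩
  · rintro ⟨nu, h1, h2⟩
    exact SCCore.hypOrbit_trans (h1.mem_hypOrbit hst ht hl)
      (SCCore.hypOrbit_symm (h2.mem_hypOrbit hst ht hm))
  · rintro ⟨v, hv, rfl⟩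
    obtain ⟨nu, hnu⟩ := SCCore.exists_isCoreOf ht lam
    obtain ⟨nu', hnu'⟩ := SCCore.exists_isCoreOf ht (SCCore.levelPart s t hst v lam)
    have : nu = nu' := SCCore.eq_of_sameCharges ht hnu.2 hnu'.2
      (((SCCore.sameCharges_of_isCoreOf hnu).symm.trans
        (SCCore.sameCharges_levelPart hst hv lam)).trans (SCCore.sameCharges_of_isCoreOf hnu'))
    exact ⟨nu, hnu, this ▸ hnu'⟩
  -- That the `t`-core is a self-conjugate `s`-core follows from its lying in the orbit.
  · have horb := h.mem_hypOrbit hst ht hl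
    refine ⟨?_, horb⟩
    obtain ⟨v, hv, rfl⟩ := horb
    exact SCCore.levelPart_mem_scCores hst ht hv hl
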